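/- Let $k$ be an algebraically closed field, let $n\ge 2$, $1\le g\le n$, $h=n+1-g$ and $m\in\mathbb N=\{0,1,2,\dots\}$. Let $K$ be the quiver with vertices $0,\dots,n$ (read modulo $n+1$) and arrows $\beta_x:x\to x+1$ for $0\le x\le g-1$ and $\alpha_x:x+1\to x$ for $g\le x\le n$, and let $\operatorname{rep}K$ be the $k$-category of its finite-dimensional representations over $k$. For integers $0\le p\le n$, $p\le q$, let $V_{(p,q)}\in\operatorname{rep}K$ be the representation with basis $e_p,\dots,e_q$, where $e_i$ lies in $V_{(p,q)}(x)$ for $x\equiv i \pmod{n+1}$, each $\beta_x$ sends $e_i$ to $e_{i+1}$ (and $e_q$ to $0$ if $q\equiv x$), and each $\alpha_x$ sends $e_i$ to $e_{i-1}$ (and $e_p$ to $0$ if $p\equiv x+1$). For arbitrary integers $p\le q$ put $V_{(p,q)}:=V_{(p',q')}$, where $p'\equiv p\pmod{n+1}$, $0\le p'\le n$, and $q'=q+p'-p$. Let $\mathbb N\tilde K$ be the quiver with vertex set $\mathbb N\times\mathbb Z$ and, for all $r\in\mathbb N$, the arrows $$(r,i)\to(r,i+1),\quad (r,i+1)\to(r+1,i)\qquad\text{for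 } i\equiv g,\dots,n \pmod{n+1},$$ $$(r,i+1)\to(r,i),\quad (r,i)\to(r+1,i+1)\qquad\text{for } i\equiv 0,\dots,g-1 \pmod{n+1}.$$ Thus every vertex $(r,s)$ has exactly two outgoing arrows, $\gamma_1:(r,s)\to(r_1,s+1)$ and $\gamma_2:(r,s)\to(r_2,s-1)$. Let $Q^P$ be the quotient quiver of $\mathbb N\tilde K$ by the translation $(r,s)\mapsto(r,s+n+1)$, and let $Q^P_m$ be its full subquiver on the classes $(r,s)_P$ with $0\le s\le n$, $0\le r\le ghm$. Set $F_P(r,s)_P:=V_{(p,q)}$, where $(0,p)$ (respectively $(0,q)$) is the starting point of the longest path of $\mathbb N\tilde K$ ending at $(r,s)$ and composed of arrows $(l,i)\to(l',i+1)$ (respectively $(l,i)\to(l',i-1)$). Write $F_P(r,s)_P=V_{(p,q)}$ with $0\le p\le n$; then in fact $1\le p\le g$. On arrows, let $F_P\gamma_1:V_{(p,q)}\to F_P(r_1,s+1)_P=V_{(p,q_1)}$ be the morphism $e_t\mapsto e_t$ ($p\le t\le q$), and let $F_P\gamma_2:V_{(p,q)}\to F_P(r_2,s-1)_P$ be the morphism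 $e_t\mapsto e_t$ into $V_{(p-1,q)}$ if $p\ge2$, and $e_t\mapsto e_{t+n+1}$ into $V_{(g,q+n+1)}$ if $p=1$. This defines a $k$-linear functor $F_P$ from the path $k$-category $kQ^P_m$ to $\operatorname{rep}K$. Let $P_m$ be the full subcategory of $\operatorname{rep}K$ whose objects are the $F_PX$ for the vertices $X$ of $Q^P_m$. Let $k(Q^P_m)$ be the quotient of $kQ^P_m$ by the ideal generated by the elements $\gamma'\gamma-\delta'\delta$, for all diamonds in $Q^P_m$, i.e. for all arrows of $Q^P_m$ of the form $$(r,s)_P\xrightarrow{\ \gamma\ }(r_1,s+1)_P\xrightarrow{\ \gamma'\ }(r+1,s)_P,\qquad (r,s)_P\xrightarrow{\ \delta\ }(r_2,s-1)_P\xrightarrow{\ \delta'\ }(r+1,s)_P$$ that are classes of such arrows of $\mathbb N\tilde K$. Then $F_P$ induces an isomorphism of $k$-categories $\overline F_P:k(Q^P_m)\to P_m$; that is, $F_P$ factors through a $k$-linear functor $\overline F_P:k(Q^P_m)\to P_m$ which is fully faithful and bijective on objects. -/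

import Mathlib

open CategoryTheory

noncomputable section

namespace AffineA

universe u v w

/-! ## `k`-categories given by a quiver with relations -/

section LinearQuotient

variable (k : Type u) [Field k]

/-- The `k`-linear functor from the `k`-linearisation of a category `C` (the same objects, formal
linear combinations of morphisms) that extends a functor from `C` to a `k`-linear category. -/
def linearLift {C : Type*} [Category C] {D : Type*} [Category D] [Preadditive D] [Linear k D]
    (F : C ⥤ D) : Free k C ⥤ D where
  obj X := F.obj X
  map {X Y} f := Finsupp.sum (show ((show C from X) ⟶ (show C from Y)) →₀ k from f)
    fun f' a => a • F.map f'
  map_id X := by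
    refine (Finsupp.sum_single_index (a := 𝟙 (show C from X)) (b := (1 : k)) (by simp)).trans ?_
    rw [one_smul]
    exact F.map_id _
  map_comp {X Y Z} f g := by
    let X' : C := X
    let Y' : C := Y
    let Z' : C := Z
    have key : ∀ (f : (X' ⟶ Y') →₀ k) (g : (Y' ⟶ Z') →₀ k),
        (Finsupp.linearCombination k (fun h : X' ⟶ Z' => F.map h))
          (f.sum fun f' s => g.sum fun g' t => Finsupp.single (f' ≫ g') (s * t)) =
        (f.sum fun f' a => a • F.map f') ≫ (g.sum fun g' a => a • F.map g') := by
      intro f g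
      simp only [Finsupp.sum, map_sum, Finsupp.linearCombination_single, Preadditive.sum_comp,
        Preadditive.comp_sum, F.map_comp, Linear.smul_comp, Linear.comp_smul, mul_smul,
        Finset.smul_sum]
      rw [Finset.sum_comm]
      exact Finset.sum_congr rfl fun _ _ => Finset.sum_congr rfl fun _ _ => smul_comm _ _ _
    exact key f g

instance linearLift_additive {C : Type*} [Category C] {D : Type*} [Category D] [Preadditive D]
    [Linear k D] (F : C ⥤ D) : (linearLift k F).Additive where
  map_add {X Y f f'} := by
    let X' : C := X
    let Y' : C := Y
    have key : ∀ f f' : (X' ⟶ Y') →₀ k, ((f + f').sum fun h a => a • F.map h) =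
        (f.sum fun h a => a • F.map h) + f'.sum fun h a => a • F.map h := fun f f' =>
      Finsupp.sum_add_index' (by simp) (by simp [add_smul])
    exact key f f'

instance linearLift_linear {C : Type*} [Category C] {D : Type*} [Category D] [Preadditive D]
    [Linear k D] (F : C ⥤ D) : (linearLift k F).Linear k where
  map_smul {X Y} f a := by
    let X' : C := X
    let Y' : C := Y
    have key : ∀ f : (X' ⟶ Y') →₀ k, ((a • f).sum fun h b => b • F.map h) =
        a • f.sum fun h b => b • F.map h := fun f => by
      rw [Finsupp.sum_smul_index (by simp), Finsupp.smul_sum]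
      simp only [mul_smul]
    exact key f

variable {C : Type v} [Category.{w} C] [Preadditive C] [Linear k C]

/-- The two-sided ideal of the `k`-category `C` generated by the differences `a - b` of the
morphisms related by `r`: its component at `(X, Y)` is the span of all `f(a - b)g`. -/
def relIdeal (r : HomRel C) (X Y : C) : Submodule k (X ⟶ Y) :=
  Submodule.span k {f | ∃ a b : X ⟶ Y, HomRel.CompClosure r a b ∧ f = a - b}

/-- Congruence modulo the ideal generated by `r`. -/
def idealRel (r : HomRel C) : HomRel C := fun X Y f g => f - g ∈ relIdeal k r X Y

variable {k} in
lemma relIdeal_comp_left (r : HomRel C) {X Y Z : C} (f : X ⟶ Y) {g : Y ⟶ Z}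
    (hg : g ∈ relIdeal k r Y Z) : f ≫ g ∈ relIdeal k r X Z := by
  induction hg using Submodule.span_induction with
  | mem x hx =>
    obtain ⟨a, b, h, rfl⟩ := hx
    rw [Preadditive.comp_sub]
    exact Submodule.subset_span ⟨_, _, HomRel.comp_left f h, rfl⟩
  | zero => simp
  | add x y _ _ hx hy => rw [Preadditive.comp_add]; exact Submodule.add_mem _ hx hy
  | smul a x _ hx => rw [Linear.comp_smul]; exact Submodule.smul_mem _ _ hx

variable {k} in
lemma relIdeal_comp_right (r : HomRel C) {X Y Z : C} {f : X ⟶ Y} (g : Y ⟶ Z)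
    (hf : f ∈ relIdeal k r X Y) : f ≫ g ∈ relIdeal k r X Z := by
  induction hf using Submodule.span_induction with
  | mem x hx =>
    obtain ⟨a, b, h, rfl⟩ := hx
    rw [Preadditive.sub_comp]
    exact Submodule.subset_span ⟨_, _, HomRel.comp_right g h, rfl⟩
  | zero => simp
  | add x y _ _ hx hy => rw [Preadditive.add_comp]; exact Submodule.add_mem _ hx hy
  | smul a x _ hx => rw [Linear.smul_comp]; exact Submodule.smul_mem _ _ hx

instance (r : HomRel C) : Congruence (idealRel k r) where
  comp_left f g g' h := by
    change _ - _ ∈ _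
    rw [← Preadditive.comp_sub]
    exact relIdeal_comp_left r f h
  comp_right g h := by
    change _ - _ ∈ _
    rw [← Preadditive.sub_comp]
    exact relIdeal_comp_right r g h
  equivalence :=
    { refl := fun f => by change f - f ∈ _; simp
      symm := fun {f g} h => by
        change g - f ∈ _
        rw [← neg_sub]; exact Submodule.neg_mem _ h
      trans := fun {f g l} h h' => by
        change f - l ∈ _
        rw [← sub_add_sub_cancel f g l]; exact Submodule.add_mem _ h h' }

/-- The quotient `C / J` of the `k`-category `C` by the ideal `J` generated by `r`. -/
abbrev LinQuotient (r : HomRel C) := CategoryTheory.Quotient (idealRel k r)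

lemma idealRel_add (r : HomRel C) ⦃X Y : C⦄ (f₁ f₂ g₁ g₂ : X ⟶ Y) (hf : idealRel k r f₁ f₂)
    (hg : idealRel k r g₁ g₂) : idealRel k r (f₁ + g₁) (f₂ + g₂) := by
  change _ - _ ∈ _
  rw [add_sub_add_comm]
  exact Submodule.add_mem _ hf hg

instance (r : HomRel C) : Preadditive (LinQuotient k r) :=
  Quotient.preadditive _ (idealRel_add k r)

instance (r : HomRel C) : (Quotient.functor (idealRel k r)).Additive :=
  Quotient.functor_additive _ (idealRel_add k r)

instance (r : HomRel C) : Linear k (LinQuotient k r) :=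
  Quotient.linear k _ fun a X Y f g h => by
    change _ - _ ∈ _
    rw [← smul_sub]
    exact Submodule.smul_mem _ a h

end LinearQuotient

/-! ## Finite-dimensional representations of a quiver -/

/-- A finite-dimensional representation over `k` of a quiver `Q`. -/
structure Rep (k : Type u) [Field k] (Q : Type v) [Quiver.{w} Q] where
  V : Q → Type u
  [addCommGroup : ∀ x, AddCommGroup (V x)]
  [module : ∀ x, Module k (V x)]
  [finite : ∀ x, Module.Finite k (V x)]
  map : ∀ {x y : Q}, (x ⟶ y) → (V x →ₗ[k] V y)

namespace Rep

attribute [instance] addCommGroup module finite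

variable {k : Type u} [Field k] {Q : Type v} [Quiver.{w} Q]

/-- Morphisms of representations: the families of linear maps that commute with the structure
maps, as a subspace of the space of all families. -/
def homSpace (V W : Rep k Q) : Submodule k (∀ x, V.V x →ₗ[k] W.V x) where
  carrier := {μ | ∀ ⦃x y : Q⦄ (γ : x ⟶ y), W.map γ ∘ₗ μ x = μ y ∘ₗ V.map γ}
  zero_mem' := by intro x y γ; simp
  add_mem' := by
    intro μ ν hμ hν x y γ
    simp [LinearMap.comp_add, LinearMap.add_comp, hμ γ, hν γ]
  smul_mem' := by
    intro a μ hμ x y γ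
    simp [LinearMap.comp_smul, LinearMap.smul_comp, hμ γ]

instance : Category (Rep k Q) where
  Hom V W := homSpace V W
  id V := ⟨fun _ => LinearMap.id, fun _ _ _ => rfl⟩
  comp μ ν := ⟨fun x => ν.1 x ∘ₗ μ.1 x, fun x y γ => by
    rw [← LinearMap.comp_assoc, ν.2 γ, LinearMap.comp_assoc, μ.2 γ, LinearMap.comp_assoc]⟩

instance : Preadditive (Rep k Q) where
  homGroup V W := inferInstanceAs (AddCommGroup (homSpace V W))
  add_comp _ _ _ _ _ _ := Subtype.ext (funext fun _ => LinearMap.comp_add _ _ _)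
  comp_add _ _ _ _ _ _ := Subtype.ext (funext fun _ => LinearMap.add_comp _ _ _)

instance : Linear k (Rep k Q) where
  homModule V W := inferInstanceAs (Module k (homSpace V W))
  smul_comp _ _ _ _ _ _ := Subtype.ext (funext fun _ => LinearMap.comp_smul _ _ _)
  comp_smul _ _ _ _ _ _ := Subtype.ext (funext fun _ => LinearMap.smul_comp _ _ _)

end Rep

/-! ## The quiver `K` and the representations `V_(p,q)` -/

/-- The vertices `0, …, n` of the quiver `K`, read modulo `n + 1`. -/
structure K (g n : ℕ) where
  v : ZMod (n + 1)

/-- The arrows of `K`: `β_x : x → x + 1` for `0 ≤ x < g` and `α_x : x + 1 → x` for `g ≤ x ≤ n`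
(so `α_n : 0 → n`). -/
inductive KArrow (g n : ℕ) : K g n → K g n → Type
  | beta (x : ZMod (n + 1)) (hx : x.val < g) : KArrow g n ⟨x⟩ ⟨x + 1⟩
  | alpha (x : ZMod (n + 1)) (hx : g ≤ x.val) : KArrow g n ⟨x + 1⟩ ⟨x⟩

instance (g n : ℕ) : Quiver (K g n) := ⟨KArrow g n⟩

/-- The indices `i` of the basis vectors `e_i` of `V_(p,q)(x)`: `p ≤ i ≤ q` and
`i ≡ x (mod n + 1)`. -/
abbrev Idx (n : ℕ) (p q : ℤ) (x : ZMod (n + 1)) : Type :=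
  {i : ℤ // p ≤ i ∧ i ≤ q ∧ (i : ZMod (n + 1)) = x}

instance (n : ℕ) (p q : ℤ) (x : ZMod (n + 1)) : Finite (Idx n p q x) :=
  Set.Finite.subset (Set.finite_Icc p q) fun _ hi => ⟨hi.1, hi.2.1⟩

section Strings

variable (k : Type u) [Field k] {n : ℕ}

/-- The vector `e_i` of `V_(p,q)(x)`, or `0` if `i` is not one of the indices of its basis. -/
def vec (p q : ℤ) (x : ZMod (n + 1)) (i : ℤ) : Idx n p q x →₀ k := by
  classical
  exact if h : p ≤ i ∧ i ≤ q ∧ (i : ZMod (n + 1)) = x then Finsupp.single ⟨i, h⟩ 1 else 0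

/-- The linear map `V_(p,q)(x) → V_(p',q')(y)` that sends `e_i` to `e_{i+c}`, read as `0` if
`V_(p',q')(y)` has no such basis vector. -/
def translate (p q : ℤ) (x : ZMod (n + 1)) (p' q' : ℤ) (y : ZMod (n + 1)) (c : ℤ) :
    (Idx n p q x →₀ k) →ₗ[k] (Idx n p' q' y →₀ k) :=
  Finsupp.linearCombination k fun i => vec k p' q' y (i.1 + c)

variable (n) in
/-- The representation `V_(p,q)` on the basis `e_p, …, e_q`: `β_x` sends `e_i` to `e_{i+1}`
(and `e_q` to `0`), `α_x` sends `e_i` to `e_{i-1}` (and `e_p` to `0`). -/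
def stringRep (g : ℕ) (p q : ℤ) : Rep k (K g n) where
  V x := Idx n p q x.v →₀ k
  finite _ := Module.Finite.finsupp
  map {x y} γ := match (γ : KArrow g n x y) with
    | KArrow.beta x _ => translate k p q x p q (x + 1) 1
    | KArrow.alpha x _ => translate k p q (x + 1) p q x (-1)

lemma translate_vec (p q : ℤ) (x : ZMod (n + 1)) (p' q' : ℤ) (y : ZMod (n + 1)) (c i : ℤ)
    (h : p ≤ i ∧ i ≤ q ∧ (i : ZMod (n + 1)) = x) :
    translate k p q x p' q' y c (vec k p q x i) = vec k p' q' y (i + c) := by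
  simp [translate, vec, h]

lemma vec_eq_zero (p q : ℤ) (x : ZMod (n + 1)) (i : ℤ)
    (h : ¬ (p ≤ i ∧ i ≤ q ∧ (i : ZMod (n + 1)) = x)) : vec k p q x i = 0 := by
  simp only [vec, dif_neg h]

lemma vec_ext {p q : ℤ} {x : ZMod (n + 1)} {M : Type*} [AddCommGroup M] [Module k M]
    {f f' : (Idx n p q x →₀ k) →ₗ[k] M}
    (h : ∀ i, p ≤ i ∧ i ≤ q ∧ (i : ZMod (n + 1)) = x → f (vec k p q x i) = f' (vec k p q x i)) :
    f = f' := by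
  refine Finsupp.lhom_ext' fun i => LinearMap.ext_ring ?_
  have := h i.1 i.2
  simpa [vec, i.2.1, i.2.2.1, i.2.2.2] using this

lemma emod_eq_val (i : ℤ) : i % (n + 1 : ℤ) = ((i : ZMod (n + 1)).val : ℤ) := by
  rw [ZMod.val_intCast]; push_cast; rfl

lemma translate_comm_beta {g : ℕ} {p q p' q' c : ℤ} (hc : (c : ZMod (n + 1)) = 0)
    (hq : g ≤ q % (n + 1 : ℤ)) (hp' : p' ≤ p + c) (hq' : q + c ≤ q') (x : ZMod (n + 1))
    (hx : x.val < g) :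
    translate k p' q' x p' q' (x + 1) 1 ∘ₗ translate k p q x p' q' x c =
      translate k p q (x + 1) p' q' (x + 1) c ∘ₗ translate k p q x p q (x + 1) 1 := by
  refine vec_ext k fun i hi => ?_
  have hne : i ≠ q := by
    rintro rfl
    rw [emod_eq_val, hi.2.2] at hq
    omega
  rw [LinearMap.comp_apply, LinearMap.comp_apply, translate_vec k _ _ _ _ _ _ _ _ hi,
    translate_vec k _ _ _ _ _ _ _ _ hi, translate_vec, translate_vec, add_right_comm]
  · exact ⟨by omega, by omega, by push_cast; rw [hi.2.2]⟩
  · exact ⟨by omega, by omega, by push_cast; rw [hi.2.2, hc, add_zero]⟩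

lemma translate_comm_alpha {g : ℕ} {p q p' q' c : ℤ} (hc : (c : ZMod (n + 1)) = 0)
    (hp : (p - 1) % (n + 1 : ℤ) < g) (hp' : p' ≤ p + c) (hq' : q + c ≤ q') (x : ZMod (n + 1))
    (hx : g ≤ x.val) :
    translate k p' q' (x + 1) p' q' x (-1) ∘ₗ translate k p q (x + 1) p' q' (x + 1) c =
      translate k p q x p' q' x c ∘ₗ translate k p q (x + 1) p q x (-1) := by
  refine vec_ext k fun i hi => ?_
  have hne : i ≠ p := by
    rintro rfl
    rw [emod_eq_val] at hp
    push_cast at hp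
    rw [hi.2.2, add_sub_cancel_right] at hp
    omega
  rw [LinearMap.comp_apply, LinearMap.comp_apply, translate_vec k _ _ _ _ _ _ _ _ hi,
    translate_vec k _ _ _ _ _ _ _ _ hi, translate_vec, translate_vec, add_right_comm]
  · exact ⟨by omega, by omega, by push_cast; rw [hi.2.2]; ring⟩
  · exact ⟨by omega, by omega, by push_cast; rw [hi.2.2, hc, add_zero]⟩

/-- The morphism `V_(p,q) → V_(p',q')`, `e_t ↦ e_{t+c}`. -/
def shiftHom (g : ℕ) {p q p' q' : ℤ} (c : ℤ) (hc : (c : ZMod (n + 1)) = 0)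
    (hp : (p - 1) % (n + 1 : ℤ) < g) (hq : g ≤ q % (n + 1 : ℤ))
    (hp' : p' ≤ p + c) (hq' : q + c ≤ q') : stringRep k n g p q ⟶ stringRep k n g p' q' :=
  ⟨fun x => translate k p q x.v p' q' x.v c, fun _ _ γ => match γ with
    | KArrow.beta x hx => translate_comm_beta k hc hq hp' hq' x hx
    | KArrow.alpha x hx => translate_comm_alpha k hc hp hp' hq' x hx⟩

end Strings

/-! ## The walk of a vertex of `ℕK̃` -/

section Walks

variable (g n : ℕ)

/-- The arrows of `ℕK̃` on the vertices `ℕ × ℤ`. Here `K̃` has the vertices `ℤ` and the arrows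
`α_i : i → i + 1` for `i ≡ g, …, n` and `β_i : i + 1 → i` for `i ≡ 0, …, g - 1` modulo `n + 1`;
an arrow `γ : i → j` of `K̃` gives `(r, γ) : (r, i) → (r, j)` and `(r, γ') : (r, j) → (r + 1, i)`.
-/
inductive NKArrow : ℕ × ℤ → ℕ × ℤ → Prop
  | alpha (r : ℕ) (i : ℤ) (hi : g ≤ i % (n + 1 : ℤ)) : NKArrow (r, i) (r, i + 1)
  | alpha' (r : ℕ) (i : ℤ) (hi : g ≤ i % (n + 1 : ℤ)) : NKArrow (r, i + 1) (r + 1, i)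
  | beta (r : ℕ) (i : ℤ) (hi : i % (n + 1 : ℤ) < g) : NKArrow (r, i + 1) (r, i)
  | beta' (r : ℕ) (i : ℤ) (hi : i % (n + 1 : ℤ) < g) : NKArrow (r, i) (r + 1, i + 1)

/-- The number of `i` with `0 ≤ i < s` and `i ≡ 0, …, g - 1 (mod n + 1)`
(counted negatively for `s < 0`). -/
def cntB (s : ℤ) : ℤ := g * (s / (n + 1 : ℤ)) + min (s % (n + 1 : ℤ)) g

/-- The integers `≡ 0, …, g - 1 (mod n + 1)` in increasing order, starting with `0` at `0`. -/
def posB (j : ℤ) : ℤ := (n + 1 : ℤ) * (j / g) + j % g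

/-- The integers `≡ g, …, n (mod n + 1)` in increasing order, starting with `g` at `0`. -/
def posA (j : ℤ) : ℤ := (n + 1 : ℤ) * (j / (n + 1 - g : ℤ)) + g + j % (n + 1 - g : ℤ)

/-- The integer `p` such that `(0, p)` is the starting point of the longest path of `ℕK̃` that
ends in `(r, s)` and is composed of arrows `(l, i) → (l', i + 1)`; see `walkStart_spec`. -/
def walkStart (r : ℕ) (s : ℤ) : ℤ := posB g n (cntB g n s - 1 - r) + 1

/-- The integer `q` such that `(0, q)` is the starting point of the longest path of `ℕK̃` that
ends in `(r, s)` and is composed of arrows `(l, i) → (l', i - 1)`; see `walkStop_spec`. -/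
def walkStop (r : ℕ) (s : ℤ) : ℤ := posA g n (s - cntB g n s + r)

/-- The normalised walk `(p', q')` with `V_(p',q') = F(r, s)`: the walk `(p, q)` above is replaced
by its translate by a multiple of `n + 1` with `0 ≤ p' ≤ n`. -/
def walk (r : ℕ) (s : ℤ) : ℤ × ℤ :=
  (walkStart g n r s % (n + 1 : ℤ),
    walkStop g n r s + walkStart g n r s % (n + 1 : ℤ) - walkStart g n r s)

variable {g n}

lemma ediv_of {N a b : ℤ} (h0 : 0 ≤ b) (h1 : b < N) : (N * a + b) / N = a := by
  rw [Int.mul_add_ediv_left _ _ (by omega), Int.ediv_eq_zero_of_lt h0 h1, add_zero]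

lemma emod_of {N a b : ℤ} (h0 : 0 ≤ b) (h1 : b < N) : (N * a + b) % N = b := by
  rw [Int.mul_add_emod_self_left, Int.emod_eq_of_lt h0 h1]

lemma exists_divmod {N : ℤ} (hN : 0 < N) (s : ℤ) : ∃ a b, 0 ≤ b ∧ b < N ∧ s = N * a + b :=
  ⟨s / N, s % N, Int.emod_nonneg _ hN.ne', Int.emod_lt_of_pos _ hN,
    (Int.mul_ediv_add_emod s N).symm⟩

lemma cntB_of {a b : ℤ} (h0 : 0 ≤ b) (h1 : b < n + 1) :
    cntB g n ((n + 1) * a + b) = g * a + min b g := by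
  rw [cntB, ediv_of h0 h1, emod_of h0 h1]

lemma posB_of {a b : ℤ} (h0 : 0 ≤ b) (h1 : b < g) :
    posB g n (g * a + b) = (n + 1) * a + b := by
  rw [posB, ediv_of h0 h1, emod_of h0 h1]

lemma posA_of {a b : ℤ} (h0 : 0 ≤ b) (h1 : b < n + 1 - g) :
    posA g n ((n + 1 - g) * a + b) = (n + 1) * a + g + b := by
  rw [posA, ediv_of h0 h1, emod_of h0 h1]

lemma cntB_succ (hg : 1 ≤ g) (hgn : g ≤ n) (s : ℤ) :
    cntB g n (s + 1) = cntB g n s + if s % (n + 1 : ℤ) < g then 1 else 0 := by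
  obtain ⟨a, b, h0, h1, rfl⟩ := exists_divmod (N := n + 1) (by omega) s
  rw [emod_of h0 h1, cntB_of h0 h1]
  rcases eq_or_ne b n with rfl | hb
  · rw [show ((n : ℤ) + 1) * a + n + 1 = (n + 1) * (a + 1) + 0 by ring,
      cntB_of le_rfl (by omega), if_neg (by omega)]
    rw [min_eq_left (by omega), min_eq_right (by omega)]
    ring
  · rw [add_assoc, cntB_of (by omega) (by omega)]
    split_ifs with h
    · rw [min_eq_left (by omega), min_eq_left (by omega)]; ring
    · rw [min_eq_right (by omega), min_eq_right (by omega)]; ring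

lemma cntB_period (s : ℤ) : cntB g n (s + (n + 1)) = cntB g n s + g := by
  obtain ⟨a, b, h0, h1, rfl⟩ := exists_divmod (N := n + 1) (by omega) s
  rw [show ((n : ℤ) + 1) * a + b + (n + 1) = (n + 1) * (a + 1) + b by ring, cntB_of h0 h1,
    cntB_of h0 h1]
  ring

lemma posB_period (hg : 1 ≤ g) (j : ℤ) : posB g n (j + g) = posB g n j + (n + 1) := by
  obtain ⟨a, b, h0, h1, rfl⟩ := exists_divmod (N := g) (by omega) j
  rw [show (g : ℤ) * a + b + g = g * (a + 1) + b by ring, posB_of h0 h1, posB_of h0 h1]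
  ring

lemma posA_period (hgn : g ≤ n) (j : ℤ) :
    posA g n (j + (n + 1 - g)) = posA g n j + (n + 1) := by
  obtain ⟨a, b, h0, h1, rfl⟩ := exists_divmod (N := n + 1 - g) (by omega) j
  rw [show ((n : ℤ) + 1 - g) * a + b + (n + 1 - g) = (n + 1 - g) * (a + 1) + b by ring,
    posA_of h0 h1, posA_of h0 h1]
  ring

lemma cntB_posB_succ (hg : 1 ≤ g) (hgn : g ≤ n) (j : ℤ) :
    cntB g n (posB g n j + 1) = j + 1 := by
  obtain ⟨a, b, h0, h1, rfl⟩ := exists_divmod (N := g) (by omega) j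
  rw [posB_of h0 h1, add_assoc, cntB_of (by omega) (by omega), min_eq_left (by omega)]
  ring

lemma posA_sub_cntB (hg : 1 ≤ g) (hgn : g ≤ n) (j : ℤ) :
    posA g n j - cntB g n (posA g n j) = j := by
  obtain ⟨a, b, h0, h1, rfl⟩ := exists_divmod (N := n + 1 - g) (by omega) j
  rw [posA_of h0 h1, add_assoc, cntB_of (by omega) (by omega), min_eq_right (by omega)]
  ring

lemma posB_emod (hg : 1 ≤ g) (hgn : g ≤ n) (j : ℤ) : posB g n j % (n + 1 : ℤ) = j % g := by
  have h0 := Int.emod_nonneg j (show (g : ℤ) ≠ 0 by omega)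
  have h1 := Int.emod_lt_of_pos j (show (0 : ℤ) < g by omega)
  rw [posB, emod_of h0 (by omega)]

lemma posA_emod (hgn : g ≤ n) (j : ℤ) :
    posA g n j % (n + 1 : ℤ) = g + j % (n + 1 - g : ℤ) := by
  have h0 := Int.emod_nonneg j (show (n + 1 - g : ℤ) ≠ 0 by omega)
  have h1 := Int.emod_lt_of_pos j (show (0 : ℤ) < n + 1 - g by omega)
  rw [posA, add_assoc, emod_of (by omega) (by omega)]

lemma posB_pred (hg : 1 ≤ g) (j : ℤ) :
    posB g n (j - 1) = if j % g = 0 then posB g n j - 1 - (n + 1 - g) else posB g n j - 1 := by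
  obtain ⟨a, b, h0, h1, rfl⟩ := exists_divmod (N := g) (by omega) j
  rw [emod_of h0 h1, posB_of h0 h1]
  split_ifs with h
  · subst h
    rw [show (g : ℤ) * a + 0 - 1 = g * (a - 1) + (g - 1) by ring, posB_of (by omega) (by omega)]
    ring
  · rw [add_sub_assoc, posB_of (by omega) (by omega)]
    ring

lemma posA_lt_succ (hgn : g ≤ n) (j : ℤ) : posA g n j < posA g n (j + 1) := by
  obtain ⟨a, b, h0, h1, rfl⟩ := exists_divmod (N := n + 1 - g) (by omega) j
  rw [posA_of h0 h1]
  rcases eq_or_ne b (n - g) with rfl | hb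
  · rw [show ((n : ℤ) + 1 - g) * a + (n - g) + 1 = (n + 1 - g) * (a + 1) + 0 by ring,
      posA_of le_rfl (by omega), mul_add]
    omega
  · rw [add_assoc _ b 1, posA_of (by omega) (by omega)]
    omega

lemma cntB_mono (hg : 1 ≤ g) (hgn : g ≤ n) (s : ℤ) (d : ℕ) :
    cntB g n s ≤ cntB g n (s + d) ∧ cntB g n (s + d) ≤ cntB g n s + d := by
  induction d with
  | zero => simp
  | succ d ih =>
    rw [Nat.cast_succ, ← add_assoc, cntB_succ hg hgn]
    split_ifs <;> omega

lemma walkStart_le (hg : 1 ≤ g) (hgn : g ≤ n) (r : ℕ) (s : ℤ) : walkStart g n r s ≤ s := by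
  by_contra! hlt
  obtain ⟨d, hd⟩ := Int.le.dest (Int.add_one_le_of_lt hlt)
  have h1 := cntB_posB_succ hg hgn (cntB g n s - 1 - r)
  have h2 := (cntB_mono hg hgn s d).1
  have h3 := cntB_succ hg hgn (s + d)
  have h4 := posB_emod hg hgn (cntB g n s - 1 - r)
  have h5 := Int.emod_lt_of_pos (cntB g n s - 1 - r) (show (0 : ℤ) < g by omega)
  have h6 : s + d = posB g n (cntB g n s - 1 - r) := by
    unfold walkStart at hd; omega
  rw [h6] at h2 h3
  rw [if_pos (by omega)] at h3
  omega

lemma le_walkStop (hg : 1 ≤ g) (hgn : g ≤ n) (r : ℕ) (s : ℤ) : s ≤ walkStop g n r s := by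
  by_contra! hlt
  obtain ⟨d, hd⟩ := Int.le.dest (Int.add_one_le_of_lt hlt)
  have h1 := posA_sub_cntB hg hgn (s - cntB g n s + r)
  have h2 := (cntB_mono hg hgn (walkStop g n r s + 1) d).2
  have h3 := cntB_succ hg hgn (walkStop g n r s)
  have h4 := posA_emod hgn (s - cntB g n s + r)
  have h5 := Int.emod_nonneg (s - cntB g n s + r) (show ((n : ℤ) + 1 - g) ≠ 0 by omega)
  rw [hd] at h2
  change walkStop g n r s - cntB g n (walkStop g n r s) = _ at h1
  change walkStop g n r s % _ = _ at h4
  rw [if_neg (by omega)] at h3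
  omega

/-- `(0, walkStart g n r s)` is the starting point of the longest path of arrows
`(l, i) → (l', i + 1)` that ends in `(r, s)`. -/
lemma walkStart_spec (hg : 1 ≤ g) (hgn : g ≤ n) (r : ℕ) (s : ℤ) :
    Relation.ReflTransGen (fun X Y => NKArrow g n X Y ∧ Y.2 = X.2 + 1)
      (0, walkStart g n r s) (r, s) ∧
    ∀ X, NKArrow g n X (0, walkStart g n r s) → X.2 + 1 ≠ walkStart g n r s := by
  constructor
  · obtain ⟨d, hd⟩ := Int.le.dest (walkStart_le hg hgn r s)
    have h1 : cntB g n (walkStart g n r s) = cntB g n s - r := by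
      rw [walkStart, cntB_posB_succ hg hgn]; ring
    generalize walkStart g n r s = p at hd h1
    have key : ∀ (d l : ℕ), cntB g n (p + d) = cntB g n p + l →
        Relation.ReflTransGen (fun X Y => NKArrow g n X Y ∧ Y.2 = X.2 + 1) (0, p) (l, p + d) := by
      intro d
      induction d with
      | zero =>
        intro l hl
        have : l = 0 := by simpa using hl.symm
        subst this
        simpa using Relation.ReflTransGen.refl
      | succ d ih =>
        intro l hl
        rw [Nat.cast_succ, ← add_assoc, cntB_succ hg hgn] at hl
        have hm := (cntB_mono hg hgn p d).1
        rw [Nat.cast_succ, ← add_assoc]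
        split_ifs at hl with hc
        · obtain ⟨l, rfl⟩ : ∃ l', l = l' + 1 := ⟨l - 1, by omega⟩
          exact (ih l (by push_cast at hl; omega)).tail ⟨NKArrow.beta' l _ hc, rfl⟩
        · exact (ih l (by omega)).tail ⟨NKArrow.alpha l _ (by omega), rfl⟩
    rw [← hd]
    exact key d r (by rw [hd, h1]; ring)
  · intro X hX hX2
    have h4 := posB_emod hg hgn (cntB g n s - 1 - r)
    have h5 := Int.emod_lt_of_pos (cntB g n s - 1 - r) (show (0 : ℤ) < g by omega)
    generalize hp : walkStart g n r s = p at *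
    have hp' : posB g n (cntB g n s - 1 - r) = p - 1 := by rw [← hp, walkStart]; ring
    rw [hp'] at h4
    cases hX with
    | alpha _ i hi =>
      rw [show i + 1 - 1 = i by ring] at h4
      omega
    | beta _ i hi => simp at hX2; omega

/-- `(0, walkStop g n r s)` is the starting point of the longest path of arrows
`(l, i) → (l', i - 1)` that ends in `(r, s)`. -/
lemma walkStop_spec (hg : 1 ≤ g) (hgn : g ≤ n) (r : ℕ) (s : ℤ) :
    Relation.ReflTransGen (fun X Y => NKArrow g n X Y ∧ Y.2 = X.2 - 1)
      (0, walkStop g n r s) (r, s) ∧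
    ∀ X, NKArrow g n X (0, walkStop g n r s) → X.2 - 1 ≠ walkStop g n r s := by
  constructor
  · obtain ⟨d, hd⟩ := Int.le.dest (le_walkStop hg hgn r s)
    have h1 : walkStop g n r s - cntB g n (walkStop g n r s) = s - cntB g n s + r :=
      posA_sub_cntB hg hgn _
    generalize walkStop g n r s = q at hd h1
    have key : ∀ (d l : ℕ) (s : ℤ), s + d = q → q - cntB g n q = s - cntB g n s + l →
        Relation.ReflTransGen (fun X Y => NKArrow g n X Y ∧ Y.2 = X.2 - 1) (0, q) (l, s) := by
      intro d
      induction d with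
      | zero =>
        intro l s hs hl
        have hs : s = q := by simpa using hs
        subst hs
        have : l = 0 := by omega
        subst this
        exact Relation.ReflTransGen.refl
      | succ d ih =>
        intro l s hs hl
        have hc := cntB_succ hg hgn s
        have hm := (cntB_mono hg hgn (s + 1) d).2
        rw [show s + 1 + d = q by push_cast at hs; omega] at hm
        split_ifs at hc with h
        · exact (ih l (s + 1) (by push_cast at hs; omega) (by omega)).tail
            ⟨NKArrow.beta l s h, by simp⟩
        · obtain ⟨l, rfl⟩ : ∃ l', l = l' + 1 := ⟨l - 1, by push_cast at hs; omega⟩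
          exact (ih l (s + 1) (by push_cast at hs; omega) (by push_cast at hl; omega)).tail
            ⟨NKArrow.alpha' l s (by omega), by simp⟩
    exact key d r s hd h1
  · intro X hX hX2
    have h4 : walkStop g n r s % _ = _ := posA_emod hgn (s - cntB g n s + r)
    have h5 := Int.emod_nonneg (s - cntB g n s + r) (show ((n : ℤ) + 1 - g) ≠ 0 by omega)
    generalize walkStop g n r s = q at *
    cases hX with
    | alpha _ i hi => simp at hX2; omega
    | beta _ i hi => omega

lemma walk_period (hg : 1 ≤ g) (hgn : g ≤ n) (r : ℕ) (s : ℤ) :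
    walk g n r (s + (n + 1)) = walk g n r s := by
  have h1 : walkStart g n r (s + (n + 1)) = walkStart g n r s + (n + 1) := by
    rw [walkStart, cntB_period, show cntB g n s + g - 1 - r = cntB g n s - 1 - r + g by ring,
      posB_period hg, walkStart]
    ring
  have h2 : walkStop g n r (s + (n + 1)) = walkStop g n r s + (n + 1) := by
    rw [walkStop, cntB_period,
      show s + (n + 1) - (cntB g n s + g) + r = s - cntB g n s + r + (n + 1 - g) by ring,
      posA_period hgn, walkStop]
  rw [walk, h1, h2, Int.add_emod_right, walk]
  congr 1
  ring

lemma walk_val_succ (hg : 1 ≤ g) (hgn : g ≤ n) (r : ℕ) (s : ZMod (n + 1)) :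
    walk g n r ((s + 1).val : ℤ) = walk g n r (s.val + 1) := by
  have hs := ZMod.val_lt s
  have h1 : (1 : ZMod (n + 1)).val = 1 := ZMod.val_one'' (by omega)
  by_cases h : s.val = n
  · have : (s + 1).val = 0 := by
      rw [ZMod.val_add, h1, h, Nat.mod_self]
    rw [this, h, ← walk_period hg hgn r]
    simp
  · rw [ZMod.val_add, h1, Nat.mod_eq_of_lt (by omega)]
    simp

lemma walk_fst (hg : 1 ≤ g) (hgn : g ≤ n) (r : ℕ) (s : ℤ) :
    (walk g n r s).1 = (cntB g n s - 1 - r) % g + 1 := by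
  have h0 := Int.emod_nonneg (cntB g n s - 1 - r) (show (g : ℤ) ≠ 0 by omega)
  have h1 := Int.emod_lt_of_pos (cntB g n s - 1 - r) (show (0 : ℤ) < g by omega)
  rw [walk, walkStart, posB, add_assoc, emod_of (by omega) (by omega)]

/-- `1 ≤ p ≤ g` and `q ≡ g, …, n (mod n + 1)` for `F(r, s) = V_(p,q)`: the walk is
post-projective. -/
lemma walk_postprojective (hg : 1 ≤ g) (hgn : g ≤ n) (r : ℕ) (s : ℤ) :
    1 ≤ (walk g n r s).1 ∧ (walk g n r s).1 ≤ g ∧ (walk g n r s).1 ≤ (walk g n r s).2 ∧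
      g ≤ (walk g n r s).2 % (n + 1 : ℤ) := by
  have h0 := Int.emod_nonneg (cntB g n s - 1 - r) (show (g : ℤ) ≠ 0 by omega)
  have h1 := Int.emod_lt_of_pos (cntB g n s - 1 - r) (show (0 : ℤ) < g by omega)
  have h2 := walkStart_le hg hgn r s
  have h3 := le_walkStop hg hgn r s
  rw [walk_fst hg hgn]
  refine ⟨by omega, by omega, ?_, ?_⟩
  · rw [← walk_fst hg hgn, walk]
    dsimp only
    omega
  · have h4 : walkStop g n r s % _ = _ := posA_emod hgn (s - cntB g n s + r)
    have h5 := Int.emod_nonneg (s - cntB g n s + r) (show ((n : ℤ) + 1 - g) ≠ 0 by omega)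
    have h6 : (walk g n r s).2 % (n + 1 : ℤ) = walkStop g n r s % (n + 1 : ℤ) := by
      rw [walk]
      dsimp only
      have := Int.mul_ediv_add_emod (walkStart g n r s) (n + 1)
      rw [show walkStop g n r s + walkStart g n r s % (n + 1 : ℤ) - walkStart g n r s =
        walkStop g n r s + (n + 1) * (-(walkStart g n r s / (n + 1))) by linarith]
      rw [Int.add_mul_emod_self_left]
    omega

/-- Along an arrow `(r, s) → (r₁, s + 1)` the walk `(p, q)` becomes `(p, q₁)` with `q ≤ q₁`. -/
lemma walk_up (hg : 1 ≤ g) (hgn : g ≤ n) (r r₁ : ℕ) (s : ℤ)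
    (hr : r₁ = r + if s % (n + 1 : ℤ) < g then 1 else 0) :
    (walk g n r₁ (s + 1)).1 = (walk g n r s).1 ∧
      (walk g n r s).2 ≤ (walk g n r₁ (s + 1)).2 := by
  have h := cntB_succ hg hgn s
  have hp : walkStart g n r₁ (s + 1) = walkStart g n r s := by
    rw [walkStart, walkStart]
    congr 2
    split_ifs at h hr <;> subst hr <;> push_cast <;> omega
  have hq : walkStop g n r s ≤ walkStop g n r₁ (s + 1) := by
    rw [walkStop, walkStop,
      show s + 1 - cntB g n (s + 1) + r₁ = s - cntB g n s + r + 1 by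
        split_ifs at h hr <;> subst hr <;> push_cast <;> omega]
    exact (posA_lt_succ hgn _).le
  rw [walk, walk, hp]
  exact ⟨rfl, by dsimp only; omega⟩

/-- Along an arrow `(r, s + 1) → (r₂, s)` the walk `(p, q)` becomes `(p - 1, q)` if `p ≥ 2`, and
`(1 - 1 - h, q)`, normalised to `(g, q + n + 1)`, if `p = 1`. -/
lemma walk_down (hg : 1 ≤ g) (hgn : g ≤ n) (r r₂ : ℕ) (s : ℤ)
    (hr : r₂ = r + if s % (n + 1 : ℤ) < g then 0 else 1) :
    walk g n r₂ s = if (walk g n r (s + 1)).1 = 1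
      then ((g : ℤ), (walk g n r (s + 1)).2 + (n + 1))
      else ((walk g n r (s + 1)).1 - 1, (walk g n r (s + 1)).2) := by
  have h := cntB_succ hg hgn s
  have hq : walkStop g n r₂ s = walkStop g n r (s + 1) := by
    rw [walkStop, walkStop]
    congr 1
    split_ifs at h hr <;> subst hr <;> push_cast <;> omega
  have hj : cntB g n s - 1 - r₂ = cntB g n (s + 1) - 1 - r - 1 := by
    split_ifs at h hr <;> subst hr <;> push_cast <;> omega
  have h1 := walk_fst hg hgn r (s + 1)
  have h2 := posB_pred (n := n) hg (cntB g n (s + 1) - 1 - r)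
  have hs1 : (walk g n r (s + 1)).2 = walkStop g n r (s + 1) + (walk g n r (s + 1)).1 -
      walkStart g n r (s + 1) := rfl
  have hs2 : (walk g n r₂ s).2 = walkStop g n r₂ s + (walk g n r₂ s).1 -
      walkStart g n r₂ s := rfl
  have h3 : (walk g n r₂ s).1 = if (walk g n r (s + 1)).1 = 1 then (g : ℤ)
      else (walk g n r (s + 1)).1 - 1 := by
    rw [walk_fst hg hgn, h1, hj]
    obtain ⟨a, b, h0, hb, he⟩ := exists_divmod (N := g) (by omega) (cntB g n (s + 1) - 1 - r)
    rw [he, emod_of h0 hb]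
    split_ifs with hif
    · rw [show (g : ℤ) * a + b - 1 = g * (a - 1) + (g - 1) by
        rw [show b = 0 by omega]; ring, emod_of (by omega) (by omega)]
      ring
    · rw [add_sub_assoc, emod_of (by omega) (by omega)]
      ring
  have h4 : walkStart g n r₂ s = if (walk g n r (s + 1)).1 = 1
      then walkStart g n r (s + 1) - 1 - (n + 1 - g) else walkStart g n r (s + 1) - 1 := by
    rw [walkStart, hj, h2, walkStart, h1]
    split_ifs <;> omega
  refine Prod.ext ?_ ?_
  · rw [h3]; split_ifs <;> rfl
  · rw [hs2, h3, h4, hq]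
    split_ifs
    · dsimp only; omega
    · dsimp only; omega

end Walks

/-! ## The tube quiver `Q^P`, its truncation, and the functor `F_P` -/

section Tube

/-- The vertices `(r, s)_P` of `Q^P`: the vertices of `ℕK̃` with `s` read modulo `n + 1`. -/
structure QP (g n : ℕ) where
  r : ℕ
  s : ZMod (n + 1)

/-- The arrows of `Q^P`: the classes of the arrows `(r, α_i)`, `(r, α_i')`, `(r, β_i)`,
`(r, β_i')` of `ℕK̃`, with `i` read modulo `n + 1`. -/
inductive QPArrow (g n : ℕ) : QP g n → QP g n → Type
  | alpha (r : ℕ) (i : ZMod (n + 1)) (hi : g ≤ i.val) : QPArrow g n ⟨r, i⟩ ⟨r, i + 1⟩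
  | alpha' (r : ℕ) (i : ZMod (n + 1)) (hi : g ≤ i.val) : QPArrow g n ⟨r, i + 1⟩ ⟨r + 1, i⟩
  | beta (r : ℕ) (i : ZMod (n + 1)) (hi : i.val < g) : QPArrow g n ⟨r, i + 1⟩ ⟨r, i⟩
  | beta' (r : ℕ) (i : ZMod (n + 1)) (hi : i.val < g) : QPArrow g n ⟨r, i⟩ ⟨r + 1, i + 1⟩

instance (g n : ℕ) : Quiver (QP g n) := ⟨QPArrow g n⟩

/-- The arrows of the form `(r, s) → (r₁, s + 1)`; the others have the form
`(r, s) → (r₂, s - 1)`. -/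
def QPArrow.IsUp {g n : ℕ} {X Y : QP g n} : QPArrow g n X Y → Prop
  | .alpha _ _ _ => True
  | .alpha' _ _ _ => False
  | .beta _ _ _ => False
  | .beta' _ _ _ => True

/-- The full subquiver `Q_m^P` of `Q^P` on the vertices `(r, s)_P` with `r ≤ g h m`, where
`h = n + 1 - g`. -/
def QPm (g n m : ℕ) : Type := {X : QP g n // X.r ≤ g * (n + 1 - g) * m}

instance (g n m : ℕ) : Quiver (QPm g n m) := ⟨fun X Y => QPArrow g n X.1 Y.1⟩

variable (k : Type u) [Field k] {g n : ℕ}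

/-- The walk `(p, q)` with `0 ≤ p ≤ n` and `F_P X = V_(p,q)`. -/
def QP.walk (X : QP g n) : ℤ × ℤ := AffineA.walk g n X.r X.s.val

/-- The representation `F_P X = V_(p,q)` for a vertex `X` of `Q^P`. -/
def FPobj (X : QP g n) : Rep k (K g n) := stringRep k n g X.walk.1 X.walk.2

/-- The image of an arrow `(r, s) → (r₁, s + 1)`: the morphism `V_(p,q) → V_(p,q₁)`, `e_t ↦ e_t`.
-/
def FPup (hg : 1 ≤ g) (hgn : g ≤ n) (r r₁ : ℕ) (s : ZMod (n + 1))
    (hr : r₁ = r + if s.val < g then 1 else 0) :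
    FPobj k (⟨r, s⟩ : QP g n) ⟶ FPobj k (⟨r₁, s + 1⟩ : QP g n) :=
  have h1 := walk_postprojective hg hgn r s.val
  have h2 := walk_up hg hgn r r₁ s.val (by
    rw [hr, Int.emod_eq_of_lt (by omega) (by have := ZMod.val_lt s; omega)]
    simp only [Nat.cast_lt])
  have h3 : QP.walk (⟨r₁, s + 1⟩ : QP g n) = AffineA.walk g n r₁ (s.val + 1) :=
    walk_val_succ hg hgn r₁ s
  shiftHom k g 0 (by simp)
    (by
      change ((AffineA.walk g n r s.val).1 - 1) % _ < _
      rw [Int.emod_eq_of_lt (by omega) (by omega)]; omega)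
    h1.2.2.2
    (by rw [h3, h2.1, add_zero]; exact le_rfl)
    (by rw [h3, add_zero]; exact h2.2)

/-- The image of an arrow `(r, s + 1) → (r₂, s)`: the morphism `e_t ↦ e_t` from `V_(p,q)` to
`V_(p-1,q)` if `p ≥ 2`, and `e_t ↦ e_{t+n+1}` from `V_(1,q)` to `V_(g,q+n+1)` if `p = 1`. -/
def FPdown (hg : 1 ≤ g) (hgn : g ≤ n) (r r₂ : ℕ) (s : ZMod (n + 1))
    (hr : r₂ = r + if s.val < g then 0 else 1) :
    FPobj k (⟨r, s + 1⟩ : QP g n) ⟶ FPobj k (⟨r₂, s⟩ : QP g n) :=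
  have h3 : QP.walk (⟨r, s + 1⟩ : QP g n) = AffineA.walk g n r (s.val + 1) :=
    walk_val_succ hg hgn r s
  have h1 := walk_postprojective hg hgn r (s.val + 1)
  have h2 : QP.walk (⟨r₂, s⟩ : QP g n) = _ := walk_down hg hgn r r₂ s.val (by
    rw [hr, Int.emod_eq_of_lt (by omega) (by have := ZMod.val_lt s; omega)]
    simp only [Nat.cast_lt])
  shiftHom k g (if (QP.walk (⟨r, s + 1⟩ : QP g n)).1 = 1 then (n : ℤ) + 1 else 0)
    (by
      split_ifs
      · have := ZMod.natCast_self (n + 1)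
        push_cast at this ⊢
        exact this
      · simp)
    (by rw [h3, Int.emod_eq_of_lt (by omega) (by omega)]; omega)
    (by rw [h3]; exact h1.2.2.2)
    (by rw [h2, h3]; split_ifs <;> dsimp only <;> omega)
    (by rw [h2, h3]; split_ifs <;> dsimp only <;> omega)

/-- `F_P` on the arrows of `Q^P`. -/
def FPmap (hg : 1 ≤ g) (hgn : g ≤ n) : ∀ {X Y : QP g n}, QPArrow g n X Y → (FPobj k X ⟶ FPobj k Y)
  | _, _, .alpha r i hi => FPup k hg hgn r r i (by rw [if_neg (by omega), add_zero])
  | _, _, .alpha' r i hi => FPdown k hg hgn r (r + 1) i (by rw [if_neg (by omega)])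
  | _, _, .beta r i hi => FPdown k hg hgn r r i (by rw [if_pos hi, add_zero])
  | _, _, .beta' r i hi => FPup k hg hgn r (r + 1) i (by rw [if_pos hi])

variable (g n)

/-- The category `P_m`: the full subcategory of `rep K` whose objects are the `F_P X` for the
vertices `X` of `Q_m^P`. -/
abbrev Pm (m : ℕ) : Type (u + 1) :=
  ObjectProperty.FullSubcategory
    (fun V : Rep k (K g n) => ∃ X : QPm g n m, V = FPobj k X.1)

variable {g n}

/-- The `k`-linear functor `F_P : kQ_m^P ⥤ P_m` on the `k`-category of paths of `Q_m^P`, given by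
`FPobj` on the vertices and by `FPmap` on the arrows. -/
def FPm (hg : 1 ≤ g) (hgn : g ≤ n) (m : ℕ) : Free k (Paths (QPm g n m)) ⥤ Pm k g n m :=
  linearLift k (Paths.lift
    { obj := fun X => ⟨FPobj k X.1, X, rfl⟩
      map := fun γ => ObjectProperty.homMk (FPmap k hg hgn γ) })

variable (g n)

/-- An arrow of `Q_m^P` as a morphism of the path category `kQ_m^P`. -/
def arrow {m : ℕ} {X Y : QPm g n m} (γ : X ⟶ Y) :
    Free.of k ((Paths.of (QPm g n m)).obj X) ⟶ Free.of k ((Paths.of (QPm g n m)).obj Y) :=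
  (Free.embedding k (Paths (QPm g n m))).map ((Paths.of (QPm g n m)).map γ)

/-- The commutativity relations `γ'γ = δ'δ` for the diamonds of `Q_m^P`, that is the images of
the diamonds of `ℕK̃`: `X = (r, s)`, `Y₁ = (r₁, s + 1)`, `Y₂ = (r₂, s - 1)`, `Z = (r + 1, s)`. -/
inductive Diamond (m : ℕ) : HomRel (Free k (Paths (QPm g n m)))
  | mk {X Y₁ Y₂ Z : QPm g n m} (γ : X ⟶ Y₁) (γ' : Y₁ ⟶ Z) (δ : X ⟶ Y₂) (δ' : Y₂ ⟶ Z)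
      (hγ : QPArrow.IsUp γ) (hγ' : ¬ QPArrow.IsUp γ')
      (hδ : ¬ QPArrow.IsUp δ) (hδ' : QPArrow.IsUp δ') :
      Diamond m (arrow k g n γ ≫ arrow k g n γ') (arrow k g n δ ≫ arrow k g n δ')

/-- The `k`-category `k(Q_m^P)` defined by the quiver `Q_m^P` with the diamond relations. -/
abbrev MeshQPm (m : ℕ) := LinQuotient k (Diamond k g n m)

/-- The projection `kQ_m^P ⥤ k(Q_m^P)`. -/
abbrev meshProj (m : ℕ) : Free k (Paths (QPm g n m)) ⥤ MeshQPm k g n m :=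
  Quotient.functor (idealRel k (Diamond k g n m))

end Tube

end AffineA

end

noncomputable section

namespace AffineA

universe u

/-! ### Morphisms between post-projective strings -/

section StringHoms

variable (k : Type u) [Field k] {n : ℕ}

/-- The coefficient of `e_j` in a vector of `V_(p,q)(x)`. -/
def coord (p q : ℤ) (x : ZMod (n + 1)) (j : ℤ) : (Idx n p q x →₀ k) →ₗ[k] k := by
  classical
  exact if h : p ≤ j ∧ j ≤ q ∧ (j : ZMod (n + 1)) = x then Finsupp.lapply ⟨j, h⟩ else 0

lemma coord_of {p q : ℤ} {x : ZMod (n + 1)} {j : ℤ}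
    (h : p ≤ j ∧ j ≤ q ∧ (j : ZMod (n + 1)) = x) (v : Idx n p q x →₀ k) :
    coord k p q x j v = v ⟨j, h⟩ := by
  simp [coord, h]

lemma coord_eq_zero {p q : ℤ} {x : ZMod (n + 1)} {j : ℤ}
    (h : ¬ (p ≤ j ∧ j ≤ q ∧ (j : ZMod (n + 1)) = x)) (v : Idx n p q x →₀ k) :
    coord k p q x j v = 0 := by
  simp only [coord, dif_neg h, LinearMap.zero_apply]

lemma coord_vec {p q : ℤ} {x : ZMod (n + 1)} {i : ℤ} (j : ℤ)
    (h : p ≤ i ∧ i ≤ q ∧ (i : ZMod (n + 1)) = x) :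
    coord k p q x j (vec k p q x i) = if i = j then 1 else 0 := by
  classical
  by_cases hj : p ≤ j ∧ j ≤ q ∧ (j : ZMod (n + 1)) = x
  · rw [coord_of k hj, vec, dif_pos h, Finsupp.single_apply]
    simp only [Subtype.mk.injEq]
  · rw [coord_eq_zero k hj, if_neg]
    rintro rfl
    exact hj h

lemma coord_ext {p q : ℤ} {x : ZMod (n + 1)} {v v' : Idx n p q x →₀ k}
    (h : ∀ j, p ≤ j ∧ j ≤ q ∧ (j : ZMod (n + 1)) = x → coord k p q x j v = coord k p q x j v') :
    v = v' := by
  ext j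
  have := h j.1 j.2
  rwa [coord_of k j.2, coord_of k j.2] at this

/-- No condition on `j - c` is needed: if it is not an index of the source, then no basis vector is
sent to e_j and both sides vanish. -/
lemma coord_translate {p q p' q' c : ℤ} {x y : ZMod (n + 1)} (hy : y = x + c) {j : ℤ}
    (hj : p' ≤ j ∧ j ≤ q') (v : Idx n p q x →₀ k) :
    coord k p' q' y j (translate k p q x p' q' y c v) = coord k p q x (j - c) v := by
  rw [← LinearMap.comp_apply]
  congr 1
  refine vec_ext k fun i hi => ?_
  rw [LinearMap.comp_apply, translate_vec k _ _ _ _ _ _ _ _ hi, coord_vec k _ hi]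
  by_cases h : p' ≤ i + c ∧ i + c ≤ q' ∧ ((i + c : ℤ) : ZMod (n + 1)) = y
  · rw [coord_vec k _ h]
    congr 1
    rw [eq_sub_iff_add_eq]
  · rw [vec_eq_zero k _ _ _ _ h, map_zero, if_neg]
    rintro rfl
    refine h ⟨by omega, by omega, ?_⟩
    push_cast [hy, ← hi.2.2]
    ring

variable {k} {g : ℕ} {p q p' q' : ℤ}

variable (x : ZMod (n + 1))

/-- The component at a vertex of a morphism between strings, as a linear function of the
morphism. -/
def stringApp : (stringRep k n g p q ⟶ stringRep k n g p' q') →ₗ[k]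
    (Idx n p q x →₀ k) →ₗ[k] (Idx n p' q' x →₀ k) :=
  LinearMap.proj (R := k) (φ := fun x : K g n => (Idx n p q x.v →₀ k) →ₗ[k] (Idx n p' q' x.v →₀ k))
    ⟨x⟩ ∘ₗ (Rep.homSpace (stringRep k n g p q) (stringRep k n g p' q')).subtype

lemma stringApp_id : stringApp x (𝟙 (stringRep k n g p q)) = LinearMap.id := rfl

lemma stringApp_comp {p'' q'' : ℤ} (f : stringRep k n g p q ⟶ stringRep k n g p' q')
    (f' : stringRep k n g p' q' ⟶ stringRep k n g p'' q'') (v : Idx n p q x →₀ k) :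
    stringApp x (f ≫ f') v = stringApp x f' (stringApp x f v) := rfl

lemma stringApp_ext {f f' : stringRep k n g p q ⟶ stringRep k n g p' q'}
    (h : ∀ x, stringApp x f = stringApp x f') : f = f' :=
  Subtype.ext (funext fun x => h x.v)

lemma stringApp_beta (f : stringRep k n g p q ⟶ stringRep k n g p' q') (hx : x.val < g)
    (v : Idx n p q x →₀ k) : translate k p' q' x p' q' (x + 1) 1 (stringApp x f v) =
      stringApp (x + 1) f (translate k p q x p q (x + 1) 1 v) :=
  LinearMap.congr_fun (f.2 (show (⟨x⟩ : K g n) ⟶ ⟨x + 1⟩ from KArrow.beta x hx)) v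

lemma stringApp_alpha (f : stringRep k n g p q ⟶ stringRep k n g p' q') (hx : g ≤ x.val)
    (v : Idx n p q (x + 1) →₀ k) : translate k p' q' (x + 1) p' q' x (-1) (stringApp (x + 1) f v) =
      stringApp x f (translate k p q (x + 1) p q x (-1) v) :=
  LinearMap.congr_fun (f.2 (show (⟨x + 1⟩ : K g n) ⟶ ⟨x⟩ from KArrow.alpha x hx)) v

variable {x}

/-- If β_x leads from e_i to e_{i+1}, then f(e_{i+1}) = β_x f(e_i), and the coefficient could be
lost only at i + c = q', where β_x kills e_{q'}; `hq'` excludes this. If α_x leads from e_{i+1} to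
e_i, the critical case is i + 1 + c = p', which `hp'` excludes. Only the target has to be
post-projective. -/
lemma coord_app_succ (hp' : (p' - 1) % (n + 1 : ℤ) < g) (hq' : g ≤ q' % (n + 1 : ℤ))
    (f : stringRep k n g p q ⟶ stringRep k n g p' q') {c : ℤ} (hc : (c : ZMod (n + 1)) = 0)
    {i : ℤ} {x : ZMod (n + 1)} (hx : (i : ZMod (n + 1)) = x) (hi : p ≤ i) (hi' : i + 1 ≤ q) :
    coord k p' q' (x + 1) (i + 1 + c) (stringApp (x + 1) f (vec k p q (x + 1) (i + 1))) =
      coord k p' q' x (i + c) (stringApp x f (vec k p q x i)) := by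
  have h0 : p ≤ i ∧ i ≤ q ∧ (i : ZMod (n + 1)) = x := ⟨hi, by omega, hx⟩
  have h1 : p ≤ i + 1 ∧ i + 1 ≤ q ∧ ((i + 1 : ℤ) : ZMod (n + 1)) = x + 1 :=
    ⟨by omega, hi', by push_cast; rw [hx]⟩
  have hic : (i + c) % (n + 1 : ℤ) = x.val := by
    rw [emod_eq_val]; push_cast; rw [hx, hc, add_zero]
  by_cases hxg : x.val < g
  · have hf := stringApp_beta x f hxg (vec k p q x i)
    rw [translate_vec k _ _ _ _ _ _ _ _ h0] at hf
    rw [← hf]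
    by_cases hr : p' ≤ i + 1 + c ∧ i + 1 + c ≤ q'
    · rw [coord_translate k (by push_cast; rfl) hr]
      congr 2
      ring
    · rw [coord_eq_zero k (by tauto), coord_eq_zero k]
      rintro ⟨h2, h3, -⟩
      have : i + c = q' := by omega
      rw [this] at hic
      omega
  · have hf := stringApp_alpha x f (by omega) (vec k p q (x + 1) (i + 1))
    rw [translate_vec k _ _ _ _ _ _ _ _ h1,
      add_neg_cancel_right] at hf
    rw [← hf]
    by_cases hr : p' ≤ i + c ∧ i + c ≤ q'
    · rw [coord_translate k (by push_cast; ring) hr]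
      congr 2
      ring
    · rw [coord_eq_zero k (x := x) (by tauto), coord_eq_zero k]
      rintro ⟨h2, h3, -⟩
      have : i + c = p' - 1 := by omega
      rw [this] at hic
      omega

/-- The coefficient of `e_{i+c}` in `f(e_i)` does not depend on `i`. -/
lemma coord_app_eq (hp' : (p' - 1) % (n + 1 : ℤ) < g) (hq' : g ≤ q' % (n + 1 : ℤ))
    (f : stringRep k n g p q ⟶ stringRep k n g p' q') {c : ℤ} (hc : (c : ZMod (n + 1)) = 0)
    {i : ℤ} (hi : p ≤ i) (hi' : i ≤ q) {x y : ZMod (n + 1)} (hx : (p : ZMod (n + 1)) = x)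
    (hy : (i : ZMod (n + 1)) = y) :
    coord k p' q' y (i + c) (stringApp y f (vec k p q y i)) =
      coord k p' q' x (p + c) (stringApp x f (vec k p q x p)) := by
  obtain ⟨d, rfl⟩ := Int.le.dest hi
  induction d generalizing y with
  | zero =>
    obtain rfl : x = y := by rw [← hx, ← hy]; simp
    simp
  | succ d ih =>
    obtain rfl : ((p + d : ℤ) : ZMod (n + 1)) + 1 = y := by
      rw [← hy]; push_cast; ring
    rw [← ih (by omega) (by push_cast at hi'; omega) rfl, Nat.cast_succ, ← add_assoc]
    exact coord_app_succ hp' hq' f hc rfl (by omega) (by push_cast at hi'; omega)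

/-- A morphism between post-projective strings is determined by its value on `e_p`. -/
lemma stringHom_ext (hp' : (p' - 1) % (n + 1 : ℤ) < g) (hq' : g ≤ q' % (n + 1 : ℤ))
    {f f' : stringRep k n g p q ⟶ stringRep k n g p' q'}
    (h : stringApp p f (vec k p q p p) = stringApp p f' (vec k p q p p)) : f = f' := by
  refine stringApp_ext fun x => vec_ext k fun i hi => coord_ext k fun j hj => ?_
  -- Every pair of indices i, j at the same vertex has the form j = i + c with c a multiple of n +
  -- 1, so each matrix entry of f is one of the constant coefficients.
  have hc : ((j - i : ℤ) : ZMod (n + 1)) = 0 := by push_cast; rw [hi.2.2, hj.2.2, sub_self]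
  have key := fun f => coord_app_eq hp' hq' (k := k) f hc hi.1 hi.2.1 rfl hi.2.2
  rw [add_sub_cancel] at key
  exact (key f).trans ((congrArg _ h).trans (key f').symm)

/-- With c = j - p, the same nonzero coefficient reappears in front of e_{q+c} in f(e_q), so e_{q+c}
must exist in the target. -/
lemma le_of_coord_app_ne_zero (hpq : p ≤ q) (hp' : (p' - 1) % (n + 1 : ℤ) < g)
    (hq' : g ≤ q' % (n + 1 : ℤ)) (f : stringRep k n g p q ⟶ stringRep k n g p' q') {j : ℤ}
    (hj : coord k p' q' p j (stringApp p f (vec k p q p p)) ≠ 0) :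
    ((j - p : ℤ) : ZMod (n + 1)) = 0 ∧ p' ≤ j ∧ q + (j - p) ≤ q' := by
  have h1 : p' ≤ j ∧ j ≤ q' ∧ (j : ZMod (n + 1)) = p := by
    by_contra h
    exact hj (coord_eq_zero k h _)
  have hc : ((j - p : ℤ) : ZMod (n + 1)) = 0 := by push_cast; rw [h1.2.2, sub_self]
  refine ⟨hc, h1.1, ?_⟩
  by_contra h
  have := coord_app_eq hp' hq' f hc hpq le_rfl rfl rfl
  rw [add_sub_cancel] at this
  exact hj (this.symm.trans (coord_eq_zero k (by tauto) _))

/-- `f` is the morphism `e_t ↦ e_{t+c}`. -/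
structure IsShift (c : ℤ) (f : stringRep k n g p q ⟶ stringRep k n g p' q') : Prop where
  cast_eq_zero : (c : ZMod (n + 1)) = 0
  first_le : p' ≤ p + c
  last_le : q + c ≤ q'
  app_eq : ∀ x, stringApp x f = translate k p q x p' q' x c

lemma isShift_shiftHom {c : ℤ} (hc : (c : ZMod (n + 1)) = 0)
    (hp : (p - 1) % (n + 1 : ℤ) < g) (hq : g ≤ q % (n + 1 : ℤ))
    (hp' : p' ≤ p + c) (hq' : q + c ≤ q') :
    IsShift c (shiftHom k g c hc hp hq hp' hq') :=
  ⟨hc, hp', hq', fun _ => rfl⟩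

lemma isShift_id : IsShift 0 (𝟙 (stringRep k n g p q)) := by
  refine ⟨by simp, by simp, by simp, fun x => vec_ext k fun i hi => ?_⟩
  rw [translate_vec k _ _ _ _ _ _ _ _ hi, add_zero, stringApp_id, LinearMap.id_apply]

lemma IsShift.app_vec {c : ℤ} {f : stringRep k n g p q ⟶ stringRep k n g p' q'}
    (h : IsShift c f) {x : ZMod (n + 1)} {i : ℤ}
    (hi : p ≤ i ∧ i ≤ q ∧ (i : ZMod (n + 1)) = x) :
    stringApp x f (vec k p q x i) = vec k p' q' x (i + c) := by
  rw [h.app_eq, translate_vec k _ _ _ _ _ _ _ _ hi]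

/-- The bounds in `IsShift` keep the intermediate vectors e_{i+c} nonzero; without them a composite
of translations could vanish where the translation by c + c' does not. -/
lemma IsShift.comp {p'' q'' c c' : ℤ} {f : stringRep k n g p q ⟶ stringRep k n g p' q'}
    {f' : stringRep k n g p' q' ⟶ stringRep k n g p'' q''} (h : IsShift c f)
    (h' : IsShift c' f') : IsShift (c + c') (f ≫ f') := by
  have h1 := h.first_le
  have h2 := h.last_le
  have h3 := h'.first_le
  have h4 := h'.last_le
  refine ⟨by push_cast; rw [h.1, h'.1, add_zero], by omega, by omega,
    fun x => vec_ext k fun i hi => ?_⟩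
  rw [stringApp_comp, h.app_vec hi, h'.app_vec,
    translate_vec k _ _ _ _ _ _ _ _ hi, add_assoc]
  refine ⟨by omega, by omega, ?_⟩
  push_cast
  rw [hi.2.2, h.1, add_zero]

lemma IsShift.eq {c : ℤ} {f f' : stringRep k n g p q ⟶ stringRep k n g p' q'}
    (h : IsShift c f) (h' : IsShift c f') : f = f' :=
  stringApp_ext fun x => (h.app_eq x).trans (h'.app_eq x).symm

lemma IsShift.coord_app_vec {c : ℤ} {f : stringRep k n g p q ⟶ stringRep k n g p' q'}
    (h : IsShift c f) (hpq : p ≤ q) (j : ℤ) :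
    coord k p' q' p j (stringApp p f (vec k p q p p)) = if p + c = j then 1 else 0 := by
  have := h.first_le
  have := h.last_le
  rw [h.app_vec ⟨le_rfl, hpq, rfl⟩, coord_vec]
  exact ⟨by omega, by omega, by push_cast; rw [h.1, add_zero]⟩

/-- By the bounds in `IsShift`, e_p goes to a genuine basis vector e_{p+c}, from which c can be read
off; this is where p ≤ q enters. -/
lemma IsShift.unique {c c' : ℤ} {f : stringRep k n g p q ⟶ stringRep k n g p' q'}
    (hpq : p ≤ q) (h : IsShift c f) (h' : IsShift c' f) : c = c' := by
  have h1 := h.coord_app_vec hpq (p + c)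
  rw [h'.coord_app_vec hpq, if_pos rfl] at h1
  by_contra hne
  rw [if_neg (by omega)] at h1
  exact zero_ne_one h1

/-- A nonzero morphism between post-projective strings comes with an admissible translation. -/
lemma exists_le_of_ne_zero (hpq : p ≤ q) (hp' : (p' - 1) % (n + 1 : ℤ) < g)
    (hq' : g ≤ q' % (n + 1 : ℤ)) {f : stringRep k n g p q ⟶ stringRep k n g p' q'}
    (hf : f ≠ 0) : ∃ c : ℤ, (c : ZMod (n + 1)) = 0 ∧ p' ≤ p + c ∧ q + c ≤ q' := by
  by_contra! h
  refine hf (stringHom_ext hp' hq' (coord_ext k fun j _ => ?_))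
  by_contra hj
  rw [map_zero, LinearMap.zero_apply, map_zero] at hj
  obtain ⟨h1, h2, h3⟩ := le_of_coord_app_ne_zero hpq hp' hq' f hj
  exact absurd (h _ h1 (by omega)) (by omega)

end StringHoms

/-! ### Coordinates of the walks and the effect of arrows on them -/

section Coordinates

variable (g n : ℕ)

/-- The coordinate `j` with `0 ≤ j < g` of a walk `(p, q) = walk g n r s`: it is `p - 1`. -/
def startIdx (r : ℕ) (s : ℤ) : ℤ := (cntB g n s - 1 - r) % g

/-- The coordinate `j` of a walk `(p, q) = walk g n r s` with `q = posA g n j`. -/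
def stopIdx (r : ℕ) (s : ℤ) : ℤ :=
  s - cntB g n s + r - (n + 1 - g) * ((cntB g n s - 1 - r) / g)

variable {g n}

/-- Each period of length n + 1 contains exactly n + 1 - g values of `posA`. -/
lemma posA_sub_mul (hgn : g ≤ n) (j t : ℤ) :
    posA g n (j - (n + 1 - g) * t) = posA g n j - (n + 1) * t := by
  obtain ⟨a, b, h0, h1, rfl⟩ := exists_divmod (N := n + 1 - g) (by omega) j
  rw [show ((n : ℤ) + 1 - g) * a + b - (n + 1 - g) * t = (n + 1 - g) * (a - t) + b by ring,
    posA_of h0 h1, posA_of h0 h1]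
  ring

lemma posA_strictMono (hgn : g ≤ n) : StrictMono (posA g n) :=
  strictMono_int_of_lt_succ fun j => posA_lt_succ hgn j

/-- Normalising p subtracts (n + 1)t from the walk, where t is the quotient of cntB - 1 - r by g. In
the numbering by `posA` this is the correction (n + 1 - g)t in `stopIdx`. -/
lemma walk_eq (hg : 1 ≤ g) (hgn : g ≤ n) (r : ℕ) (s : ℤ) :
    walk g n r s = (startIdx g n r s + 1, posA g n (stopIdx g n r s)) := by
  refine Prod.ext (walk_fst hg hgn r s) ?_
  change walkStop g n r s + (walk g n r s).1 - walkStart g n r s = posA g n (stopIdx g n r s)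
  rw [walk_fst hg hgn, walkStart, stopIdx, posA_sub_mul hgn, walkStop, posB]
  ring

lemma startIdx_up (hg : 1 ≤ g) (hgn : g ≤ n) {r r₁ : ℕ} {s : ℤ}
    (hr : r₁ = r + if s % (n + 1 : ℤ) < g then 1 else 0) :
    cntB g n (s + 1) - 1 - r₁ = cntB g n s - 1 - r := by
  have h := cntB_succ hg hgn s
  split_ifs at h hr <;> omega

lemma walk_coords_up (hg : 1 ≤ g) (hgn : g ≤ n) {r r₁ : ℕ} {s : ℤ}
    (hr : r₁ = r + if s % (n + 1 : ℤ) < g then 1 else 0) :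
    startIdx g n r₁ (s + 1) = startIdx g n r s ∧
      stopIdx g n r₁ (s + 1) = stopIdx g n r s + 1 := by
  have h := startIdx_up hg hgn hr
  rw [startIdx, startIdx, stopIdx, stopIdx, h]
  exact ⟨rfl, by linarith⟩

lemma walk_coords_down (hg : 1 ≤ g) (hgn : g ≤ n) {r r₂ : ℕ} {s : ℤ}
    (hr : r₂ = r + if s % (n + 1 : ℤ) < g then 0 else 1) :
    startIdx g n r₂ s = startIdx g n r (s + 1) - 1 +
        (if startIdx g n r (s + 1) = 0 then (g : ℤ) else 0) ∧
      stopIdx g n r₂ s = stopIdx g n r (s + 1) +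
        if startIdx g n r (s + 1) = 0 then (n + 1 - g : ℤ) else 0 := by
  have h := cntB_succ hg hgn s
  have h1 : cntB g n s - 1 - r₂ = cntB g n (s + 1) - 1 - r - 1 := by
    split_ifs at h hr <;> omega
  rw [startIdx, startIdx, stopIdx, stopIdx, h1]
  have h2 : s - cntB g n s + r₂ = s + 1 - cntB g n (s + 1) + r := by linarith
  obtain ⟨a, b, h3, h4, h5⟩ := exists_divmod (N := g) (by omega) (cntB g n (s + 1) - 1 - r)
  rw [h2, h5, emod_of h3 h4, ediv_of h3 h4]
  -- The quotient by g drops exactly when the remainder `b` is 0; this is the wrap from p = 1 to p =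
  -- g.
  split_ifs with hb
  · rw [show (g : ℤ) * a + b - 1 = g * (a - 1) + (g - 1) by rw [hb]; ring,
      emod_of (by omega) (by omega), ediv_of (by omega) (by omega), hb]
    exact ⟨by ring, by ring⟩
  · rw [add_sub_assoc, emod_of (by omega) (by omega), ediv_of (by omega) (by omega)]
    exact ⟨by ring, by ring⟩

/-- In the sum of the two coordinates `cntB` and r cancel, leaving s - 1 - (n + 1)t with t the
quotient by g. As s and s' lie in [0,n], this gives t = t' and s = s', and then r = r'. -/
lemma walk_coords_injective {r r' : ℕ} {s s' : ℤ} (hs : 0 ≤ s)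
    (hsn : s ≤ n) (hs' : 0 ≤ s') (hsn' : s' ≤ n) (h : startIdx g n r s = startIdx g n r' s')
    (h' : stopIdx g n r s = stopIdx g n r' s') : r = r' ∧ s = s' := by
  rw [startIdx, startIdx] at h
  rw [stopIdx, stopIdx] at h'
  have h1 := Int.mul_ediv_add_emod (cntB g n s - 1 - r) g
  have h2 := Int.mul_ediv_add_emod (cntB g n s' - 1 - r') g
  generalize (cntB g n s - 1 - r) / g = t at *
  generalize (cntB g n s' - 1 - r') / g = t' at *
  have h3 : s - s' = (n + 1) * (t - t') := by linear_combination h + h' - h1 + h2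
  obtain rfl : t = t' := by
    rcases lt_trichotomy t t' with hlt | heq | hlt
    · nlinarith
    · exact heq
    · nlinarith
  obtain rfl : s = s' := by linarith
  exact ⟨by omega, rfl⟩

end Coordinates

/-! ### Vertices, arrows and diamonds of the tube quiver -/

section Vertices

variable {g n : ℕ}

/-- The coordinate `p - 1` of a vertex with walk `(p, q)`. -/
def QP.startCoord (X : QP g n) : ℤ := X.walk.1 - 1

/-- The coordinate `j` of a vertex with walk `(p, q)`, `q = posA g n j`. -/
def QP.stopCoord (X : QP g n) : ℤ := stopIdx g n X.r X.s.val

lemma QP.walk_eq (hg : 1 ≤ g) (hgn : g ≤ n) (X : QP g n) :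
    X.walk = (X.startCoord + 1, posA g n X.stopCoord) := by
  refine (AffineA.walk_eq hg hgn X.r X.s.val).trans (Prod.ext ?_ rfl)
  rw [QP.startCoord, QP.walk, AffineA.walk_eq hg hgn]
  ring

lemma QP.startCoord_eq (hg : 1 ≤ g) (hgn : g ≤ n) (X : QP g n) :
    X.startCoord = startIdx g n X.r X.s.val := by
  rw [QP.startCoord, QP.walk, AffineA.walk_eq hg hgn]
  ring

lemma QP.startCoord_nonneg (hg : 1 ≤ g) (hgn : g ≤ n) (X : QP g n) : 0 ≤ X.startCoord := by
  rw [QP.startCoord_eq hg hgn]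
  exact Int.emod_nonneg _ (by omega)

lemma QP.startCoord_lt (hg : 1 ≤ g) (hgn : g ≤ n) (X : QP g n) : X.startCoord < g := by
  rw [QP.startCoord_eq hg hgn]
  exact Int.emod_lt_of_pos _ (by omega)

lemma QP.ext_coords (hg : 1 ≤ g) (hgn : g ≤ n) {X Y : QP g n} (h : X.startCoord = Y.startCoord)
    (h' : X.stopCoord = Y.stopCoord) : X = Y := by
  obtain ⟨r, s⟩ := X
  obtain ⟨r', s'⟩ := Y
  rw [QP.startCoord_eq hg hgn, QP.startCoord_eq hg hgn] at h
  have h1 := ZMod.val_lt s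
  have h2 := ZMod.val_lt s'
  obtain ⟨h3, h4⟩ := walk_coords_injective (Int.natCast_nonneg _)
    (show (s.val : ℤ) ≤ n by omega) (Int.natCast_nonneg _) (show (s'.val : ℤ) ≤ n by omega) h h'
  congr 1
  exact ZMod.val_injective _ (by exact_mod_cast h4)

lemma QP.ext_walk (hg : 1 ≤ g) (hgn : g ≤ n) {X Y : QP g n} (h : X.walk = Y.walk) : X = Y := by
  rw [QP.walk_eq hg hgn, QP.walk_eq hg hgn, Prod.mk.injEq] at h
  exact QP.ext_coords hg hgn (by linarith) ((posA_strictMono hgn).injective h.2)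

lemma QP.walk_le (hg : 1 ≤ g) (hgn : g ≤ n) (X : QP g n) : X.walk.1 ≤ X.walk.2 :=
  (walk_postprojective hg hgn X.r X.s.val).2.2.1

lemma QP.pred_walk_fst_emod (hg : 1 ≤ g) (hgn : g ≤ n) (X : QP g n) :
    (X.walk.1 - 1) % (n + 1 : ℤ) < g := by
  obtain ⟨h1, h2, -⟩ := walk_postprojective hg hgn X.r X.s.val
  change (((AffineA.walk g n X.r X.s.val).1 - 1) % _) < _
  rw [Int.emod_eq_of_lt (by omega) (by omega)]
  omega

lemma QP.walk_snd_emod (hg : 1 ≤ g) (hgn : g ≤ n) (X : QP g n) :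
    g ≤ X.walk.2 % (n + 1 : ℤ) :=
  (walk_postprojective hg hgn X.r X.s.val).2.2.2

/-- The coordinates of `(r, s + 1)_P` can be computed without reducing `s + 1`. -/
lemma stopCoord_val_succ (hg : 1 ≤ g) (hgn : g ≤ n) (r : ℕ) (s : ZMod (n + 1)) :
    QP.stopCoord (⟨r, s + 1⟩ : QP g n) = stopIdx g n r (s.val + 1) := by
  have h : QP.walk (⟨r, s + 1⟩ : QP g n) = _ := walk_val_succ hg hgn r s
  rw [QP.walk_eq hg hgn, AffineA.walk_eq hg hgn, Prod.mk.injEq] at h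
  exact (posA_strictMono hgn).injective h.2

lemma startCoord_val_succ (hg : 1 ≤ g) (hgn : g ≤ n) (r : ℕ) (s : ZMod (n + 1)) :
    QP.startCoord (⟨r, s + 1⟩ : QP g n) = startIdx g n r (s.val + 1) := by
  have h : QP.walk (⟨r, s + 1⟩ : QP g n) = _ := walk_val_succ hg hgn r s
  rw [QP.walk_eq hg hgn, AffineA.walk_eq hg hgn, Prod.mk.injEq] at h
  linarith

lemma val_emod (s : ZMod (n + 1)) : (s.val : ℤ) % (n + 1 : ℤ) = s.val :=
  Int.emod_eq_of_lt (by omega) (by have := ZMod.val_lt s; omega)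

variable {X Y : QP g n}

lemma QPArrow.coords_of_isUp (hg : 1 ≤ g) (hgn : g ≤ n) (γ : QPArrow g n X Y) (h : γ.IsUp) :
    Y.startCoord = X.startCoord ∧ Y.stopCoord = X.stopCoord + 1 := by
  cases γ with
  | alpha r i hi =>
    rw [startCoord_val_succ hg hgn, stopCoord_val_succ hg hgn, QP.startCoord_eq hg hgn]
    exact walk_coords_up hg hgn (by rw [val_emod, if_neg (by exact_mod_cast hi.not_gt), add_zero])
  | alpha' r i hi => exact h.elim
  | beta r i hi => exact h.elim
  | beta' r i hi =>
    rw [startCoord_val_succ hg hgn, stopCoord_val_succ hg hgn, QP.startCoord_eq hg hgn]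
    exact walk_coords_up hg hgn (by rw [val_emod, if_pos (by exact_mod_cast hi)])

lemma QPArrow.coords_of_not_isUp (hg : 1 ≤ g) (hgn : g ≤ n) (γ : QPArrow g n X Y)
    (h : ¬ γ.IsUp) :
    Y.startCoord = X.startCoord - 1 + (if X.startCoord = 0 then (g : ℤ) else 0) ∧
      Y.stopCoord = X.stopCoord + if X.startCoord = 0 then (n + 1 - g : ℤ) else 0 := by
  cases γ with
  | alpha r i hi => exact absurd trivial h
  | beta' r i hi => exact absurd trivial h
  | alpha' r i hi =>
    rw [startCoord_val_succ hg hgn, stopCoord_val_succ hg hgn, QP.startCoord_eq hg hgn]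
    exact walk_coords_down hg hgn (by rw [val_emod, if_neg (by exact_mod_cast hi.not_gt)])
  | beta r i hi =>
    rw [startCoord_val_succ hg hgn, stopCoord_val_succ hg hgn, QP.startCoord_eq hg hgn]
    exact walk_coords_down hg hgn (by rw [val_emod, if_pos (by exact_mod_cast hi), add_zero])

lemma QPArrow.r_le (γ : QPArrow g n X Y) : X.r ≤ Y.r := by
  cases γ <;> simp

variable (X) in
lemma exists_up : ∃ (Y : QP g n) (γ : QPArrow g n X Y), γ.IsUp := by
  obtain ⟨r, s⟩ := X
  by_cases h : s.val < g
  · exact ⟨_, .beta' r s h, trivial⟩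
  · exact ⟨_, .alpha r s (not_lt.1 h), trivial⟩

variable (X) in
lemma exists_down : ∃ (Y : QP g n) (γ : QPArrow g n X Y), ¬ γ.IsUp := by
  obtain ⟨r, s⟩ := X
  obtain ⟨s, rfl⟩ : ∃ t, t + 1 = s := ⟨s - 1, by ring⟩
  by_cases h : s.val < g
  · exact ⟨_, .beta r s h, fun h => h⟩
  · exact ⟨_, .alpha' r s (not_lt.1 h), fun h => h⟩

lemma up_unique {Y' : QP g n} (γ : QPArrow g n X Y) (γ' : QPArrow g n X Y') (h : γ.IsUp)
    (h' : γ'.IsUp) : (⟨Y, γ⟩ : Σ Y, QPArrow g n X Y) = ⟨Y', γ'⟩ := by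
  cases γ with
  | alpha' => exact h.elim
  | beta => exact h.elim
  | alpha r i hi =>
    cases γ' with
    | alpha => rfl
    | beta' r i hi' => omega
    | alpha' => exact h'.elim
    | beta => exact h'.elim
  | beta' r i hi =>
    cases γ' with
    | beta' => rfl
    | alpha r i hi' => omega
    | alpha' => exact h'.elim
    | beta => exact h'.elim

/-- Down arrows have a source of the form (r, i + 1), on which case analysis of two arrows with a
common source cannot unify directly. The sources are therefore kept separate, with their equality as
a hypothesis. -/
lemma down_unique_aux {X' Y' : QP g n} (γ : QPArrow g n X Y) (γ' : QPArrow g n X' Y')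
    (h : ¬ γ.IsUp) (h' : ¬ γ'.IsUp) (hX : X = X') :
    (⟨X, Y, γ⟩ : Σ X Y, QPArrow g n X Y) = ⟨X', Y', γ'⟩ := by
  cases γ with
  | alpha => exact absurd trivial h
  | beta' => exact absurd trivial h
  | alpha' r i hi =>
    cases γ' with
    | alpha => exact absurd trivial h'
    | beta' => exact absurd trivial h'
    | alpha' r' i' hi' =>
      simp only [QP.mk.injEq, add_left_inj] at hX
      obtain ⟨rfl, rfl⟩ := hX
      rfl
    | beta r' i' hi' =>
      simp only [QP.mk.injEq, add_left_inj] at hX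
      obtain ⟨rfl, rfl⟩ := hX
      omega
  | beta r i hi =>
    cases γ' with
    | alpha => exact absurd trivial h'
    | beta' => exact absurd trivial h'
    | beta r' i' hi' =>
      simp only [QP.mk.injEq, add_left_inj] at hX
      obtain ⟨rfl, rfl⟩ := hX
      rfl
    | alpha' r' i' hi' =>
      simp only [QP.mk.injEq, add_left_inj] at hX
      obtain ⟨rfl, rfl⟩ := hX
      omega

lemma down_unique {Y' : QP g n} (γ : QPArrow g n X Y) (γ' : QPArrow g n X Y') (h : ¬ γ.IsUp)
    (h' : ¬ γ'.IsUp) : (⟨Y, γ⟩ : Σ Y, QPArrow g n X Y) = ⟨Y', γ'⟩ := by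
  simpa using down_unique_aux γ γ' h h' rfl

/-- An arrow down followed by an arrow up is one side of a diamond. -/
lemma exists_diamond {Z : QP g n} (δ : QPArrow g n X Y) (δ' : QPArrow g n Y Z) (h : ¬ δ.IsUp)
    (h' : δ'.IsUp) :
    ∃ (Y₁ : QP g n) (γ : QPArrow g n X Y₁) (γ' : QPArrow g n Y₁ Z), γ.IsUp ∧ ¬ γ'.IsUp := by
  obtain ⟨Z', hZ⟩ : ∃ Z' : QP g n, Z' = ⟨X.r + 1, X.s⟩ := ⟨_, rfl⟩
  -- The up arrow crosses back the residue i crossed by the down arrow, and exactly one of the two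
  -- raises r, according to whether i < g.
  have h1 : Z = Z' := by
    rw [hZ]
    cases δ with
    | alpha => exact absurd trivial h
    | beta' => exact absurd trivial h
    | alpha' r i hi =>
      cases δ' with
      | alpha => rfl
      | beta' r i hi' => omega
      | alpha' => exact h'.elim
      | beta => exact h'.elim
    | beta r i hi =>
      cases δ' with
      | beta' => rfl
      | alpha r i hi' => omega
      | alpha' => exact h'.elim
      | beta => exact h'.elim
  obtain ⟨r, s⟩ := X
  rw [h1, hZ]
  -- The other side of the diamond crosses the residue s and returns, again raising r exactly once.
  by_cases hs : s.val < g
  · exact ⟨_, .beta' r s hs, .beta (r + 1) s hs, trivial, fun h => h⟩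
  · exact ⟨_, .alpha r s (not_lt.1 hs), .alpha' r s (not_lt.1 hs), trivial, fun h => h⟩

end Vertices

/-! ### Normal form of paths modulo the diamond relations -/

section MeshPaths

variable {g n : ℕ}

/-- `1` for the arrows `(r, s) → (r₁, s + 1)` and `0` for the others. -/
def QPArrow.upCount {X Y : QP g n} : QPArrow g n X Y → ℕ
  | .alpha _ _ _ => 1
  | .alpha' _ _ _ => 0
  | .beta _ _ _ => 0
  | .beta' _ _ _ => 1

/-- `1` for the arrows `(r, s) → (r₂, s - 1)` and `0` for the others. -/
def QPArrow.downCount {X Y : QP g n} : QPArrow g n X Y → ℕ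
  | .alpha _ _ _ => 0
  | .alpha' _ _ _ => 1
  | .beta _ _ _ => 1
  | .beta' _ _ _ => 0

lemma QPArrow.counts {X Y : QP g n} (γ : QPArrow g n X Y) :
    (γ.IsUp ∧ γ.upCount = 1 ∧ γ.downCount = 0) ∨ (¬ γ.IsUp ∧ γ.upCount = 0 ∧ γ.downCount = 1) := by
  cases γ
  · exact Or.inl ⟨trivial, rfl, rfl⟩
  · exact Or.inr ⟨fun h => h, rfl, rfl⟩
  · exact Or.inr ⟨fun h => h, rfl, rfl⟩
  · exact Or.inl ⟨trivial, rfl, rfl⟩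

variable {m : ℕ}

/-- The number of arrows `(r, s) → (r₁, s + 1)` of a path. -/
def ups {X Y : QPm g n m} (w : Quiver.Path X Y) : ℕ :=
  w.addWeight fun γ => QPArrow.upCount γ

/-- The number of arrows `(r, s) → (r₂, s - 1)` of a path. -/
def downs {X Y : QPm g n m} (w : Quiver.Path X Y) : ℕ :=
  w.addWeight fun γ => QPArrow.downCount γ

lemma ups_cons {X Y Z : QPm g n m} (w : Quiver.Path X Y) (γ : Y ⟶ Z) :
    ups (w.cons γ) = ups w + QPArrow.upCount γ :=
  Quiver.Path.addWeight_cons _ w γ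

lemma downs_cons {X Y Z : QPm g n m} (w : Quiver.Path X Y) (γ : Y ⟶ Z) :
    downs (w.cons γ) = downs w + QPArrow.downCount γ :=
  Quiver.Path.addWeight_cons _ w γ

lemma ups_nil (X : QPm g n m) : ups (Quiver.Path.nil : Quiver.Path X X) = 0 :=
  Quiver.Path.addWeight_nil _ X

lemma downs_nil (X : QPm g n m) : downs (Quiver.Path.nil : Quiver.Path X X) = 0 :=
  Quiver.Path.addWeight_nil _ X

lemma sigma_arrow_eq {X Y Y' : QPm g n m} {γ : X ⟶ Y} {γ' : X ⟶ Y'}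
    (h : (⟨Y.1, γ⟩ : Σ Z, QPArrow g n X.1 Z) = ⟨Y'.1, γ'⟩) :
    (⟨Y, γ⟩ : Σ Z : QPm g n m, X ⟶ Z) = ⟨Y', γ'⟩ := by
  obtain ⟨Y, hY⟩ := Y
  obtain ⟨Y', hY'⟩ := Y'
  cases h
  rfl

/-- A path of arrows `(r, s) → (r₁, s + 1)` is determined by its source and its length. -/
lemma up_path_unique {X Y Y' : QPm g n m} (w : Quiver.Path X Y) (w' : Quiver.Path X Y')
    (h : downs w = 0) (h' : downs w' = 0) (he : ups w = ups w') :
    (⟨Y, w⟩ : Σ Z, Quiver.Path X Z) = ⟨Y', w'⟩ := by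
  induction w generalizing Y' with
  | nil =>
    cases w' with
    | nil => rfl
    | cons w' γ' =>
      have := QPArrow.counts γ'
      rw [downs_cons] at h'
      rw [ups_nil, ups_cons] at he
      omega
  | cons w γ ih =>
    have h1 := QPArrow.counts γ
    rw [downs_cons] at h
    rw [ups_cons] at he
    cases w' with
    | nil =>
      rw [ups_nil] at he
      omega
    | cons w' γ' =>
      have h2 := QPArrow.counts γ'
      rw [downs_cons] at h'
      rw [ups_cons] at he
      cases ih w' (by omega) (by omega) (by omega)
      cases sigma_arrow_eq (up_unique γ γ' (h1.resolve_right (by omega)).1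
        (h2.resolve_right (by omega)).1)
      rfl

/-- A path of arrows `(r, s) → (r₂, s - 1)` is determined by its source and its length. -/
lemma down_path_unique {X Y Y' : QPm g n m} (w : Quiver.Path X Y) (w' : Quiver.Path X Y')
    (h : ups w = 0) (h' : ups w' = 0) (he : downs w = downs w') :
    (⟨Y, w⟩ : Σ Z, Quiver.Path X Z) = ⟨Y', w'⟩ := by
  induction w generalizing Y' with
  | nil =>
    cases w' with
    | nil => rfl
    | cons w' γ' =>
      have := QPArrow.counts γ'
      rw [ups_cons] at h'
      rw [downs_nil, downs_cons] at he
      omega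
  | cons w γ ih =>
    have h1 := QPArrow.counts γ
    rw [ups_cons] at h
    rw [downs_cons] at he
    cases w' with
    | nil =>
      rw [downs_nil] at he
      omega
    | cons w' γ' =>
      have h2 := QPArrow.counts γ'
      rw [ups_cons] at h'
      rw [downs_cons] at he
      cases ih w' (by omega) (by omega) (by omega)
      cases sigma_arrow_eq (down_unique γ γ' (h1.resolve_left (by omega)).1
        (h2.resolve_left (by omega)).1)
      rfl

variable (k : Type u) [Field k]

/-- A vertex of `Q_m^P` as an object of `k(Q_m^P)`. -/
abbrev meshObj (X : QPm g n m) : MeshQPm k g n m :=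
  (meshProj k g n m).obj ((Free.embedding k (Paths (QPm g n m))).obj ((Paths.of _).obj X))

/-- The residue class in `k(Q_m^P)` of a path of `Q_m^P`. -/
def pathClass {X Y : QPm g n m} (w : Quiver.Path X Y) : meshObj k X ⟶ meshObj k Y :=
  (meshProj k g n m).map ((Free.embedding k (Paths (QPm g n m))).map
    (show (Paths.of _).obj X ⟶ (Paths.of _).obj Y from w))

/-- The residue class in `k(Q_m^P)` of an arrow of `Q_m^P`. -/
def arrowClass {X Y : QPm g n m} (γ : X ⟶ Y) : meshObj k X ⟶ meshObj k Y :=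
  (meshProj k g n m).map (arrow k g n γ)

lemma pathClass_nil (X : QPm g n m) : pathClass k (Quiver.Path.nil : Quiver.Path X X) = 𝟙 _ := by
  refine Eq.trans ?_ ((meshProj k g n m).map_id _)
  exact congrArg (meshProj k g n m).map ((Free.embedding k (Paths (QPm g n m))).map_id _)

lemma pathClass_cons {X Y Z : QPm g n m} (w : Quiver.Path X Y) (γ : Y ⟶ Z) :
    pathClass k (w.cons γ) = pathClass k w ≫ arrowClass k γ := by
  refine Eq.trans ?_ ((meshProj k g n m).map_comp _ _)
  refine congrArg (meshProj k g n m).map ?_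
  exact (Free.embedding k (Paths (QPm g n m))).map_comp
    (show (Paths.of _).obj X ⟶ (Paths.of _).obj Y from w) ((Paths.of _).map γ)

lemma arrowClass_diamond {X Y₁ Y₂ Z : QPm g n m} (γ : X ⟶ Y₁) (γ' : Y₁ ⟶ Z) (δ : X ⟶ Y₂)
    (δ' : Y₂ ⟶ Z) (hγ : QPArrow.IsUp γ) (hγ' : ¬ QPArrow.IsUp γ') (hδ : ¬ QPArrow.IsUp δ)
    (hδ' : QPArrow.IsUp δ') :
    arrowClass k γ ≫ arrowClass k γ' = arrowClass k δ ≫ arrowClass k δ' := by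
  refine ((meshProj k g n m).map_comp _ _).symm.trans
    (Eq.trans ?_ ((meshProj k g n m).map_comp _ _))
  refine CategoryTheory.Quotient.sound _ (Submodule.subset_span ⟨_, _, ?_, rfl⟩)
  exact HomRel.CompClosure.of (Diamond.mk γ γ' δ δ' hγ hγ' hδ hδ')

/-- This is one sorting step: the final up arrow is moved across the down arrows of `w` one at a
time, each time replacing one side of a diamond by the other. -/
lemma exists_swap {X Y Z : QPm g n m} (w : Quiver.Path X Y) (hw : ups w = 0) (γ : Y ⟶ Z)
    (hγ : QPArrow.IsUp γ) :
    ∃ (X' : QPm g n m) (γ' : X ⟶ X') (w' : Quiver.Path X' Z), QPArrow.IsUp γ' ∧ ups w' = 0 ∧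
      downs w' = downs w ∧ pathClass k w ≫ arrowClass k γ = arrowClass k γ' ≫ pathClass k w' := by
  induction w generalizing Z with
  | nil =>
    refine ⟨Z, γ, .nil, hγ, ups_nil Z, by rw [downs_nil, downs_nil], ?_⟩
    rw [pathClass_nil, pathClass_nil, Category.id_comp, Category.comp_id]
  | @cons Y₀ Y₂ w δ ih =>
    have h1 := QPArrow.counts δ
    rw [ups_cons] at hw
    have hδ : ¬ QPArrow.IsUp δ := (h1.resolve_left (by omega)).1
    obtain ⟨Y₁, ε, ε', hε, hε'⟩ := exists_diamond δ γ hδ hγ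
    have h2 := QPArrow.counts ε'
    -- The new corner stays in the truncated quiver, because r does not decrease along the arrow
    -- from it to `Z`.
    let Y₁' : QPm g n m := ⟨Y₁, ε'.r_le.trans Z.2⟩
    obtain ⟨X', γ', w', h3, h4, h5, h6⟩ := ih (by omega) (show Y₀ ⟶ Y₁' from ε) hε
    refine ⟨X', γ', w'.cons (show Y₁' ⟶ Z from ε'), h3, ?_, ?_, ?_⟩
    · rw [ups_cons, h4, (h2.resolve_left (fun h => hε' h.1)).2.1]
    · rw [downs_cons, downs_cons, h5, (h2.resolve_left (fun h => hε' h.1)).2.2,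
        (h1.resolve_left (fun h => hδ h.1)).2.2]
    · rw [pathClass_cons, pathClass_cons, Category.assoc, ← Category.assoc (arrowClass k γ'), ← h6,
        Category.assoc, arrowClass_diamond k (show Y₀ ⟶ Y₁' from ε) ε' δ γ hε hε' hδ hγ]

/-- Modulo the diamond relations the arrows `(r, s) → (r₁, s + 1)` of a path can be moved to its
beginning. -/
lemma exists_sorted {X Y : QPm g n m} (w : Quiver.Path X Y) :
    ∃ (M : QPm g n m) (u : Quiver.Path X M) (d : Quiver.Path M Y), downs u = 0 ∧ ups d = 0 ∧
      ups u = ups w ∧ downs d = downs w ∧ pathClass k w = pathClass k u ≫ pathClass k d := by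
  induction w with
  | nil =>
    exact ⟨X, .nil, .nil, downs_nil X, ups_nil X, rfl, rfl, by rw [pathClass_nil, Category.id_comp]⟩
  | cons w γ ih =>
    obtain ⟨M, u, d, h1, h2, h3, h4, h5⟩ := ih
    rcases QPArrow.counts γ with ⟨hγ, c1, c2⟩ | ⟨hγ, c1, c2⟩
    · obtain ⟨X', γ', d', h6, h7, h8, h9⟩ := exists_swap k d h2 γ hγ
      obtain ⟨-, c3, c4⟩ := (QPArrow.counts γ').resolve_right fun h => h.1 h6
      refine ⟨X', u.cons γ', d', ?_, h7, ?_, ?_, ?_⟩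
      · rw [downs_cons, h1, c4]
      · rw [ups_cons, ups_cons, h3, c3, c1]
      · rw [downs_cons, h8, h4, c2, add_zero]
      · rw [pathClass_cons, pathClass_cons, h5, Category.assoc, h9, Category.assoc]
    · refine ⟨M, u, d.cons γ, h1, ?_, ?_, ?_, ?_⟩
      · rw [ups_cons, h2, c1]
      · rw [ups_cons, h3, c1, add_zero]
      · rw [downs_cons, downs_cons, h4]
      · rw [pathClass_cons, pathClass_cons, h5, Category.assoc]

/-- Paths with the same end points and the same numbers of arrows of both kinds are equal modulo
the diamond relations. -/
lemma pathClass_eq {X Y : QPm g n m} (w w' : Quiver.Path X Y) (hu : ups w = ups w')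
    (hd : downs w = downs w') : pathClass k w = pathClass k w' := by
  obtain ⟨M, u, d, h1, h2, h3, h4, h5⟩ := exists_sorted k w
  obtain ⟨M', u', d', h1', h2', h3', h4', h5'⟩ := exists_sorted k w'
  -- The sorted up parts have the same source and length, so they agree together with their end
  -- points; then the down parts have the same source as well.
  cases up_path_unique u u' h1 h1' (by omega)
  cases down_path_unique d d' h2 h2' (by omega)
  rw [h5, h5']

/-- Every morphism of `k(Q_m^P)` is a linear combination of paths. -/
lemma span_pathClass (X Y : QPm g n m) :
    Submodule.span k (Set.range fun w : Quiver.Path X Y => pathClass k w) = ⊤ := by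
  let L : (Quiver.Path X Y →₀ k) →ₗ[k] (meshObj k X ⟶ meshObj k Y) :=
    (meshProj k g n m).mapLinearMap k
  have hL : L = Finsupp.linearCombination k (fun w : Quiver.Path X Y => pathClass k w) :=
    Finsupp.lhom_ext' fun w => LinearMap.ext_ring
      ((Finsupp.linearCombination_single k 1 w).trans (one_smul k (pathClass k w))).symm
  rw [← Finsupp.range_linearCombination, ← hL]
  exact LinearMap.range_eq_top.2 (meshProj k g n m).map_surjective

end MeshPaths

/-! ### Images of paths under the functor are exactly the admissible translations -/

section PathImages

variable {k : Type u} [Field k] {g n m : ℕ}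

/-- `f : F_P X → F_P Y` is the morphism `e_t ↦ e_{t+c}`. -/
abbrev IsFPShift {X Y : QP g n} (c : ℤ) (f : FPobj k X ⟶ FPobj k Y) : Prop :=
  IsShift (k := k) (p := X.walk.1) (q := X.walk.2) (p' := Y.walk.1) (q' := Y.walk.2) c f

lemma isFPShift_FPup (hg : 1 ≤ g) (hgn : g ≤ n) {r r₁ : ℕ} {s : ZMod (n + 1)}
    (hr : r₁ = r + if s.val < g then 1 else 0) : IsFPShift 0 (FPup k hg hgn r r₁ s hr) := by
  unfold FPup
  apply isShift_shiftHom

lemma isFPShift_FPdown (hg : 1 ≤ g) (hgn : g ≤ n) {r r₂ : ℕ} {s : ZMod (n + 1)}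
    (hr : r₂ = r + if s.val < g then 0 else 1) :
    IsFPShift (if (QP.walk (⟨r, s + 1⟩ : QP g n)).1 = 1 then (n : ℤ) + 1 else 0)
      (FPdown k hg hgn r r₂ s hr) := by
  unfold FPdown
  apply isShift_shiftHom

lemma isFPShift_of_isUp (hg : 1 ≤ g) (hgn : g ≤ n) {X Y : QP g n} (γ : QPArrow g n X Y)
    (h : γ.IsUp) : IsFPShift 0 (FPmap k hg hgn γ) := by
  cases γ with
  | alpha r i hi => exact isFPShift_FPup hg hgn (by rw [if_neg (by omega), add_zero])
  | alpha' r i hi => exact h.elim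
  | beta r i hi => exact h.elim
  | beta' r i hi => exact isFPShift_FPup hg hgn (by rw [if_pos hi])

lemma isFPShift_of_not_isUp (hg : 1 ≤ g) (hgn : g ≤ n) {X Y : QP g n} (γ : QPArrow g n X Y)
    (h : ¬ γ.IsUp) :
    IsFPShift (if X.walk.1 = 1 then (n : ℤ) + 1 else 0) (FPmap k hg hgn γ) := by
  cases γ with
  | alpha r i hi => exact absurd trivial h
  | alpha' r i hi => exact isFPShift_FPdown hg hgn (by rw [if_neg (by omega)])
  | beta r i hi => exact isFPShift_FPdown hg hgn (by rw [if_pos hi, add_zero])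
  | beta' r i hi => exact absurd trivial h

/-- The effect of an arrow on the coordinates, and the translation by which `F_P` represents it. -/
lemma arrow_spec (hg : 1 ≤ g) (hgn : g ≤ n) {X Y : QP g n} (γ : QPArrow g n X Y) :
    ∃ z : ℤ, IsFPShift ((n + 1) * z) (FPmap k hg hgn γ) ∧
      Y.startCoord = X.startCoord - γ.downCount + g * z ∧
      Y.stopCoord = X.stopCoord + γ.upCount + (n + 1 - g) * z := by
  rcases γ.counts with ⟨h, h1, h2⟩ | ⟨h, h1, h2⟩
  · obtain ⟨h3, h4⟩ := γ.coords_of_isUp hg hgn h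
    refine ⟨0, ?_, by rw [h3, h2]; simp, by rw [h4, h1]; simp⟩
    rw [mul_zero]
    exact isFPShift_of_isUp hg hgn γ h
  · obtain ⟨h3, h4⟩ := γ.coords_of_not_isUp hg hgn h
    have h5 := isFPShift_of_not_isUp (k := k) hg hgn γ h
    rw [h3, h4, h1, h2]
    by_cases h0 : X.startCoord = 0
    · rw [if_pos (show X.walk.1 = 1 by rw [QP.startCoord] at h0; omega)] at h5
      refine ⟨1, by rwa [mul_one], ?_, ?_⟩
      · rw [if_pos h0]; simp
      · rw [if_pos h0]; simp
    · rw [if_neg (show ¬ X.walk.1 = 1 by rw [QP.startCoord] at h0; omega)] at h5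
      refine ⟨0, by rwa [mul_zero], ?_, ?_⟩
      · rw [if_neg h0]; simp
      · rw [if_neg h0]; simp

variable (k) in
/-- `F_P` on the vertices and arrows of `Q_m^P`, with values in `P_m`. -/
def FPprefunctor (hg : 1 ≤ g) (hgn : g ≤ n) (m : ℕ) : QPm g n m ⥤q Pm k g n m where
  obj X := ⟨FPobj k X.1, X, rfl⟩
  map γ := ObjectProperty.homMk (FPmap k hg hgn γ)

variable (k) in
/-- The image of a path of `Q_m^P` under `F_P`. -/
def FPpath (hg : 1 ≤ g) (hgn : g ≤ n) {X Y : QPm g n m} (w : Quiver.Path X Y) :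
    FPobj k X.1 ⟶ FPobj k Y.1 :=
  ((Paths.lift (FPprefunctor k hg hgn m)).map
    (show (Paths.of _).obj X ⟶ (Paths.of _).obj Y from w)).hom

/-- The integer z counts the down arrows of the path that leave a vertex with p = 1. Between fixed
ends the equations make z determine both arrow counts, and the number of down arrows determines z.
-/
lemma path_spec (hg : 1 ≤ g) (hgn : g ≤ n) {X Y : QPm g n m} (w : Quiver.Path X Y) :
    ∃ z : ℤ, IsFPShift ((n + 1) * z) (FPpath k hg hgn w) ∧
      Y.1.startCoord = X.1.startCoord - downs w + g * z ∧
      Y.1.stopCoord = X.1.stopCoord + ups w + (n + 1 - g) * z := by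
  induction w with
  | nil =>
    refine ⟨0, ?_, by rw [downs_nil]; simp, by rw [ups_nil]; simp⟩
    rw [mul_zero]
    exact isShift_id
  | cons w γ ih =>
    obtain ⟨z, h1, h2, h3⟩ := ih
    obtain ⟨z', h1', h2', h3'⟩ := arrow_spec (k := k) hg hgn γ
    refine ⟨z + z', ?_, ?_, ?_⟩
    · rw [mul_add]
      exact h1.comp h1'
    · rw [h2', h2, downs_cons]
      push_cast
      ring
    · rw [h3', h3, ups_cons]
      push_cast
      ring

/-- A vertex `(r, s)_P` with `r ≤ g h m` as a vertex of `Q_m^P`. -/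
def QPm.of (X : QP g n) (hX : X.r ≤ g * (n + 1 - g) * m) : QPm g n m := ⟨X, hX⟩

/-- From every vertex of `Q^P` there is a path with prescribed numbers of arrows of both kinds. -/
lemma exists_path_counts (hg : 1 ≤ g) (hgn : g ≤ n) (X : QP g n) (a b : ℕ) :
    ∃ (Y : QP g n) (z : ℤ), X.r ≤ Y.r ∧ Y.startCoord = X.startCoord - b + g * z ∧
      Y.stopCoord = X.stopCoord + a + (n + 1 - g) * z ∧
      ∀ (m : ℕ) (hX : X.r ≤ g * (n + 1 - g) * m) (hY : Y.r ≤ g * (n + 1 - g) * m),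
        ∃ w : Quiver.Path (QPm.of X hX) (QPm.of Y hY), ups w = a ∧ downs w = b := by
  induction b with
  | zero =>
    induction a with
    | zero => exact ⟨X, 0, le_rfl, by simp, by simp, fun m hX _ => ⟨.nil, ups_nil _, downs_nil _⟩⟩
    | succ a ih =>
      obtain ⟨Y, z, h1, h2, h3, h4⟩ := ih
      obtain ⟨Z, γ, hγ⟩ := exists_up Y
      obtain ⟨h5, h6⟩ := γ.coords_of_isUp hg hgn hγ
      obtain ⟨-, h7, h8⟩ := γ.counts.resolve_right fun h => h.1 hγ
      refine ⟨Z, z, h1.trans γ.r_le, h5.trans h2, ?_, fun m hX hZ => ?_⟩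
      · rw [h6, h3]; push_cast; ring
      · obtain ⟨w, h9, h10⟩ := h4 m hX (γ.r_le.trans hZ)
        refine ⟨w.cons (show QPm.of Y (γ.r_le.trans hZ) ⟶ QPm.of Z hZ from γ), ?_, ?_⟩
        · exact (ups_cons w _).trans (congrArg₂ (· + ·) h9 h7)
        · exact (downs_cons w _).trans (congrArg₂ (· + ·) h10 h8)
  | succ b ih =>
    obtain ⟨Y, z, h1, h2, h3, h4⟩ := ih
    obtain ⟨Z, γ, hγ⟩ := exists_down Y
    -- Only the coordinates are used here, and they do not depend on the field, so any field serves.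
    obtain ⟨z', -, h5, h6⟩ := arrow_spec (k := ℚ) hg hgn γ
    obtain ⟨-, h7, h8⟩ := γ.counts.resolve_left fun h => hγ h.1
    refine ⟨Z, z + z', h1.trans γ.r_le, ?_, ?_, fun m hX hZ => ?_⟩
    · rw [h5, h2, h8]; push_cast; ring
    · rw [h6, h3, h7]; push_cast; ring
    · obtain ⟨w, h9, h10⟩ := h4 m hX (γ.r_le.trans hZ)
      refine ⟨w.cons (show QPm.of Y (γ.r_le.trans hZ) ⟶ QPm.of Z hZ from γ), ?_, ?_⟩
      · exact (ups_cons w _).trans (congrArg₂ (· + ·) h9 h7)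
      · exact (downs_cons w _).trans (congrArg₂ (· + ·) h10 h8)

lemma intCast_zmod_eq_zero_iff {c : ℤ} : (c : ZMod (n + 1)) = 0 ↔ ∃ z : ℤ, c = (n + 1) * z := by
  rw [ZMod.intCast_zmod_eq_zero_iff_dvd]
  push_cast
  rfl

lemma eq_of_mul_sub {N a b z z' : ℤ} (ha : 0 ≤ a) (haN : a < N) (hb : 0 ≤ b) (hbN : b < N)
    (h : a - b = N * (z - z')) : z = z' := by
  rcases lt_trichotomy z z' with hlt | heq | hlt
  · nlinarith
  · exact heq
  · nlinarith

/-- Every admissible translation is the image of a path. -/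
lemma exists_path_isFPShift (hg : 1 ≤ g) (hgn : g ≤ n) {X Y : QPm g n m} {c : ℤ}
    (hc : (c : ZMod (n + 1)) = 0) (h : Y.1.walk.1 ≤ X.1.walk.1 + c)
    (h' : X.1.walk.2 + c ≤ Y.1.walk.2) :
    ∃ w : Quiver.Path X Y, IsFPShift c (FPpath k hg hgn w) := by
  obtain ⟨z, rfl⟩ := intCast_zmod_eq_zero_iff.1 hc
  simp only [QP.walk_eq hg hgn] at h h'
  have hX0 := X.1.startCoord_nonneg hg hgn
  have hY0 := Y.1.startCoord_nonneg hg hgn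
  have hX1 := X.1.startCoord_lt hg hgn
  have hY1 := Y.1.startCoord_lt hg hgn
  -- A negative z would make p + (n + 1)z negative, since p ≤ g ≤ n, whereas the target starts at an
  -- index at least 1.
  have hz : 0 ≤ z := by
    -- The bound is linear once z ≤ -1 is multiplied by n + 1.
    by_contra! hz
    nlinarith
  obtain ⟨b, hb⟩ : ∃ b : ℕ, (b : ℤ) = X.1.startCoord - Y.1.startCoord + g * z := by
    -- The value of b is forced by `path_spec`. For z = 0 it is nonnegative by the condition on the
    -- first indices; for z ≥ 1 the summand gz outweighs a difference of two numbers in [0,g).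
    refine ⟨_, Int.toNat_of_nonneg ?_⟩
    rcases hz.eq_or_lt with rfl | hz
    · simp only [mul_zero, add_zero] at h ⊢
      linarith
    · nlinarith
  obtain ⟨a, ha⟩ : ∃ a : ℕ, (a : ℤ) = Y.1.stopCoord - X.1.stopCoord - (n + 1 - g) * z := by
    -- The value of a is forced as well; it is nonnegative because `posA` is strictly increasing and
    -- turns the condition on the last indices into one on the second coordinates.
    refine ⟨_, Int.toNat_of_nonneg ?_⟩
    have h1 := posA_sub_mul hgn X.1.stopCoord (-z)
    have h2 : posA g n (X.1.stopCoord - (n + 1 - g) * -z) ≤ posA g n Y.1.stopCoord := by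
      rw [h1]; linarith
    have h3 := (posA_strictMono hgn).le_iff_le.1 h2
    linarith
  obtain ⟨Y', z', -, h1, h2, h3⟩ := exists_path_counts hg hgn X.1 a b
  -- The first coordinates of both vertices lie in [0,g) and differ by a multiple of g, so the
  -- numbers of wraps agree and hence both coordinates do.
  have hY' : Y' = Y.1 := by
    have h4 : Y'.startCoord - Y.1.startCoord = g * (z' - z) := by rw [h1, hb]; ring
    obtain rfl := eq_of_mul_sub (Y'.startCoord_nonneg hg hgn) (Y'.startCoord_lt hg hgn) hY0 hY1 h4
    refine QP.ext_coords hg hgn (by linarith) ?_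
    rw [h2, ha]
    ring
  subst hY'
  obtain ⟨w, h4, h5⟩ : ∃ w : Quiver.Path X Y, ups w = a ∧ downs w = b := h3 m X.2 Y.2
  obtain ⟨y, h6, h7, h8⟩ := path_spec (k := k) hg hgn w
  refine ⟨w, ?_⟩
  rw [h5, hb] at h7
  have h9 : (g : ℤ) * (y - z) = 0 := by linarith
  rcases mul_eq_zero.1 h9 with h9 | h9
  · omega
  · rwa [sub_eq_zero.1 h9] at h6

/-- Two paths that `F_P` represents by the same translation are equal modulo the diamond
relations. -/
lemma pathClass_eq_of_isFPShift (hg : 1 ≤ g) (hgn : g ≤ n) {X Y : QPm g n m} {c : ℤ}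
    {w w' : Quiver.Path X Y} (h : IsFPShift c (FPpath k hg hgn w))
    (h' : IsFPShift c (FPpath k hg hgn w')) : pathClass k w = pathClass k w' := by
  obtain ⟨z, h1, h2, h3⟩ := path_spec (k := k) hg hgn w
  obtain ⟨z', h1', h2', h3'⟩ := path_spec (k := k) hg hgn w'
  have hX := X.1.walk_le hg hgn
  -- Uniqueness of the translation identifies the wrap counts of the two paths; the coordinate
  -- equations then give equal arrow counts.
  have h4 : ((n : ℤ) + 1) * z = (n + 1) * z' := by
    rw [← h.unique hX h1, h'.unique hX h1']
  obtain rfl := mul_left_cancel₀ (by omega) h4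
  exact pathClass_eq k w w' (by omega) (by omega)

end PathImages

/-! ### The induced functor, its inverse on morphisms, and bijectivity on objects -/

section InducedFunctor

variable {k : Type u} [Field k] {g n m : ℕ}

lemma FPm_map_embedding (hg : 1 ≤ g) (hgn : g ≤ n) {X Y : QPm g n m} (w : Quiver.Path X Y) :
    (FPm k hg hgn m).map ((Free.embedding k (Paths (QPm g n m))).map
      (show (Paths.of _).obj X ⟶ (Paths.of _).obj Y from w)) =
      ObjectProperty.homMk (FPpath k hg hgn w) := by
  refine (Finsupp.sum_single_index (a := w) (b := (1 : k))
    (h := fun w a => a • (Paths.lift (FPprefunctor k hg hgn m)).map w) (zero_smul k _)).trans ?_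
  exact one_smul k _

lemma FPm_diamond (hg : 1 ≤ g) (hgn : g ≤ n) {X Y : Free k (Paths (QPm g n m))} {f f' : X ⟶ Y}
    (h : Diamond k g n m f f') : (FPm k hg hgn m).map f = (FPm k hg hgn m).map f' := by
  cases h with
  | @mk X Y₁ Y₂ Z γ γ' δ δ' hγ hγ' hδ hδ' =>
    have key : FPpath k hg hgn (((Quiver.Path.nil : Quiver.Path X X).cons γ).cons γ') =
        FPpath k hg hgn (((Quiver.Path.nil : Quiver.Path X X).cons δ).cons δ') := by
      obtain ⟨h1, h2⟩ := QPArrow.coords_of_isUp hg hgn γ hγ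
      have hw : X.1.walk.1 = Y₁.1.walk.1 := by
        rw [QP.startCoord, QP.startCoord] at h1
        linarith
      have h3 := ((isShift_id.comp (isFPShift_of_isUp (k := k) hg hgn γ hγ)).comp
        (isFPShift_of_not_isUp (k := k) hg hgn γ' hγ'))
      have h4 := ((isShift_id.comp (isFPShift_of_not_isUp (k := k) hg hgn δ hδ)).comp
        (isFPShift_of_isUp (k := k) hg hgn δ' hδ'))
      -- Whether a wrap occurs depends only on p, which up arrows preserve; so both sides of the
      -- diamond translate by the same amount.
      have hc : (0 + 0 + if Y₁.1.walk.1 = 1 then (n : ℤ) + 1 else 0) =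
          (0 + if X.1.walk.1 = 1 then (n : ℤ) + 1 else 0) + 0 := by
        rw [hw]
        ring
      rw [hc] at h3
      exact h3.eq h4
    have h1 : ∀ {Y : QPm g n m} (γ : X ⟶ Y) (γ' : Y ⟶ Z),
        arrow k g n γ ≫ arrow k g n γ' = (Free.embedding k (Paths (QPm g n m))).map
          (show (Paths.of _).obj X ⟶ (Paths.of _).obj Z from
            ((Quiver.Path.nil : Quiver.Path X X).cons γ).cons γ') := fun γ γ' =>
      ((Free.embedding k (Paths (QPm g n m))).map_comp ((Paths.of _).map γ)
        ((Paths.of _).map γ')).symm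
    rw [h1, h1]
    refine (FPm_map_embedding hg hgn _).trans (Eq.trans ?_ (FPm_map_embedding hg hgn _).symm)
    exact congrArg ObjectProperty.homMk key

/-- By linearity the morphisms killed by the functor form an ideal, so it suffices to treat the
diamonds that generate the relations. -/
lemma FPm_map_eq (hg : 1 ≤ g) (hgn : g ≤ n) (X Y : Free k (Paths (QPm g n m))) (f f' : X ⟶ Y)
    (h : idealRel k (Diamond k g n m) f f') :
    (FPm k hg hgn m).map f = (FPm k hg hgn m).map f' := by
  have : (FPm k hg hgn m).Additive := inferInstanceAs (linearLift k _).Additive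
  have : (FPm k hg hgn m).Linear k := inferInstanceAs ((linearLift k _).Linear k)
  rw [← sub_eq_zero, ← Functor.map_sub]
  change f - f' ∈ relIdeal k (Diamond k g n m) X Y at h
  generalize f - f' = x at h ⊢
  induction h using Submodule.span_induction with
  | mem x hx =>
    obtain ⟨a, b, hab, rfl⟩ := hx
    cases hab with
    | intro c d e e₁ e₂ e' he =>
      rw [Functor.map_sub, sub_eq_zero, Functor.map_comp, Functor.map_comp, Functor.map_comp,
        Functor.map_comp, FPm_diamond hg hgn he]
  | zero => exact Functor.map_zero _ _ _
  | add x y _ _ hx hy => rw [Functor.map_add, hx, hy, add_zero]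
  | smul a x _ hx => rw [Functor.map_smul, hx, smul_zero]

variable (k m) in
/-- The functor `k(Q_m^P) ⥤ P_m` induced by `F_P`. -/
def FPbar (hg : 1 ≤ g) (hgn : g ≤ n) : MeshQPm k g n m ⥤ Pm k g n m :=
  CategoryTheory.Quotient.lift (idealRel k (Diamond k g n m)) (FPm k hg hgn m) (FPm_map_eq hg hgn)

lemma meshProj_comp_FPbar (hg : 1 ≤ g) (hgn : g ≤ n) :
    meshProj k g n m ⋙ FPbar k m hg hgn = FPm k hg hgn m :=
  CategoryTheory.Quotient.lift_spec _ _ _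

instance FPbar_additive (hg : 1 ≤ g) (hgn : g ≤ n) : (FPbar k m hg hgn).Additive where
  map_add {X Y f f'} := by
    obtain ⟨f, rfl⟩ := (meshProj k g n m).map_surjective f
    obtain ⟨f', rfl⟩ := (meshProj k g n m).map_surjective f'
    have : (FPm k hg hgn m).Additive := inferInstanceAs (linearLift k _).Additive
    rw [← Functor.map_add]
    exact (FPm k hg hgn m).map_add

instance FPbar_linear (hg : 1 ≤ g) (hgn : g ≤ n) : (FPbar k m hg hgn).Linear k where
  map_smul {X Y} f a := by
    obtain ⟨f, rfl⟩ := (meshProj k g n m).map_surjective f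
    have : (FPm k hg hgn m).Linear k := inferInstanceAs ((linearLift k _).Linear k)
    refine (congrArg (FPbar k m hg hgn).map ((meshProj k g n m).map_smul a f).symm).trans ?_
    exact (FPm k hg hgn m).map_smul a f

/-- The induced functor on morphisms, with values in the morphisms of representations. -/
def FPbarMap (hg : 1 ≤ g) (hgn : g ≤ n) (X Y : QPm g n m) :
    (meshObj k X ⟶ meshObj k Y) →ₗ[k] (FPobj k X.1 ⟶ FPobj k Y.1) :=
  (ObjectProperty.ι fun V : Rep k (K g n) => ∃ X : QPm g n m, V = FPobj k X.1).mapLinearMap k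
    (X := (FPbar k m hg hgn).obj (meshObj k X)) (Y := (FPbar k m hg hgn).obj (meshObj k Y)) ∘ₗ
    (FPbar k m hg hgn).mapLinearMap k (X := meshObj k X) (Y := meshObj k Y)

lemma FPbarMap_pathClass (hg : 1 ≤ g) (hgn : g ≤ n) {X Y : QPm g n m} (w : Quiver.Path X Y) :
    FPbarMap hg hgn X Y (pathClass k w) = FPpath k hg hgn w :=
  congrArg InducedCategory.Hom.hom (FPm_map_embedding hg hgn w)

open Classical in
/-- The residue class of a path that `F_P` represents by `e_t ↦ e_{t+c}`, if there is one. -/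
def shiftClass (hg : 1 ≤ g) (hgn : g ≤ n) (X Y : QPm g n m) (c : ℤ) : meshObj k X ⟶ meshObj k Y :=
  -- The value 0 is a mere default: a basis vector that occurs in f(e_p) for a morphism f always
  -- gives an admissible translation, hence a path.
  if h : ∃ w : Quiver.Path X Y, IsFPShift c (FPpath k hg hgn w) then pathClass k h.choose else 0

lemma shiftClass_eq (hg : 1 ≤ g) (hgn : g ≤ n) {X Y : QPm g n m} {c : ℤ} {w : Quiver.Path X Y}
    (h : IsFPShift c (FPpath k hg hgn w)) : shiftClass hg hgn X Y c = pathClass k w := by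
  have h' : ∃ w : Quiver.Path X Y, IsFPShift c (FPpath k hg hgn w) := ⟨w, h⟩
  rw [shiftClass, dif_pos h']
  exact pathClass_eq_of_isFPShift hg hgn h'.choose_spec h

/-- The value of a morphism `F_P X → F_P Y`, `F_P X = V_(p,q)`, on `e_p`. -/
def evalStart (X Y : QP g n) : (FPobj k X ⟶ FPobj k Y) →ₗ[k]
    (Idx n Y.walk.1 Y.walk.2 (X.walk.1 : ZMod (n + 1)) →₀ k) :=
  LinearMap.applyₗ (vec k X.walk.1 X.walk.2 (X.walk.1 : ZMod (n + 1)) X.walk.1) ∘ₗ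
    stringApp (X.walk.1 : ZMod (n + 1))

lemma evalStart_injective (hg : 1 ≤ g) (hgn : g ≤ n) (X Y : QP g n) :
    Function.Injective (evalStart (k := k) X Y) := fun _ _ h =>
  stringHom_ext (Y.pred_walk_fst_emod hg hgn) (Y.walk_snd_emod hg hgn) h

lemma evalStart_of_isFPShift (hg : 1 ≤ g) (hgn : g ≤ n) {X Y : QP g n} {c : ℤ}
    {f : FPobj k X ⟶ FPobj k Y} (h : IsFPShift c f) :
    evalStart X Y f = vec k Y.walk.1 Y.walk.2 (X.walk.1 : ZMod (n + 1)) (X.walk.1 + c) :=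
  h.app_vec ⟨le_rfl, X.walk_le hg hgn, rfl⟩

lemma vec_coe {p q : ℤ} {x : ZMod (n + 1)} (i : Idx n p q x) :
    vec k p q x i.1 = Finsupp.single i 1 :=
  dif_pos i.2

/-- The inverse of the induced functor on morphisms. -/
def FPbarInv (hg : 1 ≤ g) (hgn : g ≤ n) (X Y : QPm g n m) :
    (FPobj k X.1 ⟶ FPobj k Y.1) →ₗ[k] (meshObj k X ⟶ meshObj k Y) :=
  Finsupp.linearCombination k (fun i => shiftClass hg hgn X Y (i.1 - X.1.walk.1)) ∘ₗ
    evalStart X.1 Y.1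

/-- It suffices to check path classes: a path of translation c sends e_p to e_{p+c}, from which c
and thus the class is recovered. -/
lemma FPbarInv_FPbarMap (hg : 1 ≤ g) (hgn : g ≤ n) (X Y : QPm g n m)
    (f : meshObj k X ⟶ meshObj k Y) : FPbarInv hg hgn X Y (FPbarMap hg hgn X Y f) = f := by
  suffices h : FPbarInv hg hgn X Y ∘ₗ FPbarMap hg hgn X Y = LinearMap.id (R := k) from
    LinearMap.congr_fun h f
  refine LinearMap.ext_on (span_pathClass k X Y) ?_
  rintro _ ⟨w, rfl⟩
  obtain ⟨z, h, -⟩ := path_spec (k := k) hg hgn w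
  have h1 := h.first_le
  have h2 := h.last_le
  have h3 := X.1.walk_le hg hgn
  let i : Idx n Y.1.walk.1 Y.1.walk.2 (X.1.walk.1 : ZMod (n + 1)) :=
    ⟨X.1.walk.1 + (n + 1) * z, h1, by omega, by rw [Int.cast_add, h.cast_eq_zero, add_zero]⟩
  rw [LinearMap.comp_apply, FPbarMap_pathClass, FPbarInv, LinearMap.comp_apply,
    evalStart_of_isFPShift hg hgn h, show X.1.walk.1 + (n + 1) * z = i.1 from rfl, vec_coe,
    Finsupp.linearCombination_single, one_smul]
  refine shiftClass_eq hg hgn ?_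
  rwa [show i.1 = X.1.walk.1 + (n + 1) * z from rfl, add_sub_cancel_left]

/-- A morphism is determined by its value on e_p, so both sides are compared there, one basis vector
of the support at a time. -/
lemma FPbarMap_FPbarInv (hg : 1 ≤ g) (hgn : g ≤ n) (X Y : QPm g n m)
    (f : FPobj k X.1 ⟶ FPobj k Y.1) : FPbarMap hg hgn X Y (FPbarInv hg hgn X Y f) = f := by
  refine evalStart_injective hg hgn X.1 Y.1 ?_
  rw [FPbarInv, LinearMap.comp_apply, Finsupp.linearCombination_apply, Finsupp.sum, map_sum,
    map_sum]
  conv_rhs => rw [← Finsupp.sum_single (evalStart X.1 Y.1 f), Finsupp.sum]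
  refine Finset.sum_congr rfl fun i hi => ?_
  have hne : coord k Y.1.walk.1 Y.1.walk.2 (X.1.walk.1 : ZMod (n + 1)) i.1 (evalStart X.1 Y.1 f) ≠
      0 := by
    rw [coord_of k i.2]
    exact Finsupp.mem_support_iff.1 hi
  obtain ⟨h1, h2, h3⟩ := le_of_coord_app_ne_zero (X.1.walk_le hg hgn)
    (Y.1.pred_walk_fst_emod hg hgn) (Y.1.walk_snd_emod hg hgn) f hne
  obtain ⟨w, hw⟩ := exists_path_isFPShift (k := k) hg hgn (X := X) (Y := Y) h1 (by omega) h3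
  rw [shiftClass_eq hg hgn hw, map_smul, map_smul, FPbarMap_pathClass,
    evalStart_of_isFPShift hg hgn hw, add_sub_cancel, vec_coe, Finsupp.smul_single, smul_eq_mul,
    mul_one]

lemma FPbarMap_bijective (hg : 1 ≤ g) (hgn : g ≤ n) (X Y : QPm g n m) :
    Function.Bijective (FPbarMap (k := k) hg hgn X Y) :=
  ⟨Function.LeftInverse.injective (FPbarInv_FPbarMap hg hgn X Y),
    Function.RightInverse.surjective (FPbarMap_FPbarInv hg hgn X Y)⟩

/-- The identity is nonzero because it fixes e_p; hence an isomorphism is nonzero and some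
admissible translation exists. -/
lemma exists_translation_of_iso (hg : 1 ≤ g) (hgn : g ≤ n) {X Y : QP g n}
    (e : FPobj k X ≅ FPobj k Y) :
    ∃ c : ℤ, (c : ZMod (n + 1)) = 0 ∧ Y.walk.1 ≤ X.walk.1 + c ∧ X.walk.2 + c ≤ Y.walk.2 := by
  have hid : (𝟙 (FPobj k X)) ≠ 0 := fun h0 => by
    have h1 := evalStart_of_isFPShift hg hgn (X := X) (Y := X) (isShift_id (k := k))
    have h2 : evalStart X X (𝟙 (FPobj k X)) = 0 := by rw [h0, map_zero]
    have h3 := X.walk_le hg hgn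
    have h4 := (congrArg (coord k X.walk.1 X.walk.2 (X.walk.1 : ZMod (n + 1)) X.walk.1)
      (h1.symm.trans h2))
    rw [add_zero, coord_vec k _ ⟨le_rfl, h3, rfl⟩, map_zero, if_pos rfl] at h4
    exact one_ne_zero h4
  have he : e.hom ≠ 0 := fun h0 => hid (by rw [← e.hom_inv_id, h0, Limits.zero_comp])
  exact exists_le_of_ne_zero (X.walk_le hg hgn) (Y.pred_walk_fst_emod hg hgn)
    (Y.walk_snd_emod hg hgn) he

/-- Different vertices of `Q^P` have nonisomorphic images. -/
lemma eq_of_iso (hg : 1 ≤ g) (hgn : g ≤ n) {X Y : QP g n} (e : FPobj k X ≅ FPobj k Y) : X = Y := by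
  obtain ⟨c, hc, h1, h2⟩ := exists_translation_of_iso hg hgn e
  obtain ⟨c', -, h1', h2'⟩ := exists_translation_of_iso hg hgn e.symm
  obtain ⟨z, rfl⟩ := intCast_zmod_eq_zero_iff.1 hc
  -- The first indices give c + c' ≥ 0 and the last ones c + c' ≤ 0, so all the inequalities are
  -- equalities. As both strings start in [1,g] and g ≤ n, the translation is then 0.
  have h3 : X.walk.1 + (n + 1) * z = Y.walk.1 := by omega
  have h4 : X.walk.2 + (n + 1) * z = Y.walk.2 := by omega
  obtain ⟨a1, a2, -⟩ := walk_postprojective hg hgn X.r X.s.val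
  obtain ⟨b1, b2, -⟩ := walk_postprojective hg hgn Y.r Y.s.val
  change 1 ≤ X.walk.1 at a1
  change X.walk.1 ≤ g at a2
  change 1 ≤ Y.walk.1 at b1
  change Y.walk.1 ≤ g at b2
  obtain rfl : z = 0 := eq_of_mul_sub (N := n + 1) (a := Y.walk.1) (b := X.walk.1) (by omega)
    (by omega) (by omega) (by omega) (by rw [sub_zero]; omega)
  refine QP.ext_walk hg hgn (Prod.ext ?_ ?_)
  · rw [← h3, mul_zero, add_zero]
  · rw [← h4, mul_zero, add_zero]

lemma FPbar_isIso (hg : 1 ≤ g) (hgn : g ≤ n) : (FPbar k m hg hgn).IsIso where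
  faithful := ⟨fun {X Y} _ _ h =>
    (FPbarMap_bijective hg hgn X.as Y.as).1 (congrArg (fun f => f.hom) h)⟩
  full := ⟨fun {X Y} f => by
    obtain ⟨f', hf⟩ := (FPbarMap_bijective hg hgn X.as Y.as).2 f.hom
    exact ⟨f', ObjectProperty.hom_ext _ hf⟩⟩
  bijective_obj := by
    constructor
    · rintro ⟨X⟩ ⟨Y⟩ h
      have h1 : FPobj k (show QPm g n m from X).1 = FPobj k (show QPm g n m from Y).1 :=
        congrArg (fun V : Pm k g n m => V.obj) h
      -- An equality of objects is used only through the isomorphism it induces, which already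
      -- separates the vertices.
      have h2 : (show QPm g n m from X) = (show QPm g n m from Y) :=
        Subtype.ext (eq_of_iso hg hgn (eqToIso h1))
      exact congrArg (meshObj k) h2
    · rintro ⟨V, X, rfl⟩
      exact ⟨meshObj k X, rfl⟩

end InducedFunctor

end AffineA

end

theorem mainTheorem3 {k : Type*} [Field k] [IsAlgClosed k] (n g m : ℕ) (hn : 2 ≤ n)
    (hg : 1 ≤ g) (hgn : g ≤ n) :
    ∃ Fbar : AffineA.MeshQPm k g n m ⥤ AffineA.Pm k g n m,
      AffineA.meshProj k g n m ⋙ Fbar = AffineA.FPm k hg hgn m ∧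
        Fbar.Additive ∧ Fbar.Linear k ∧ Fbar.IsIso :=
  ⟨AffineA.FPbar k m hg hgn, AffineA.meshProj_comp_FPbar hg hgn, AffineA.FPbar_additive hg hgn,
    AffineA.FPbar_linear hg hgn, AffineA.FPbar_isIso hg hgn⟩
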